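/- Let $F$ be a free group (of any rank), and let $H$ and $K$ be nontrivial finitely generated subgroups of $F$, of ranks $h$ and $k$ respectively, where the rank of a finitely generated free group is its minimal number of generators (equivalently, the cardinality of a free basis). For $g\in F$ write $K^g=gKg^{-1}$. Then: (1) $H\cap K$ is finitely generated and \[ \mathrm{rank}(H\cap K)-1\ \le\ 2(h-1)(k-1)-\min\{h-1,\,k-1\}. \] (2) For every $g\in F$ the group $H\cap K^g$ is finitely generated. Moreover, if $X\subseteq F$ is any set of representatives for the double cosets $H\backslash F/K$ (one element from each $HgK$), then the set $Y=\{g\in X : H\cap K^g\neq 1\}$ is finite and \[ \sum_{g\in Y}\bigl(\mathrm{rank}(H\cap K^g)-1\bigr)\ \le\ 2(h-1)(k-1)-\min\{h-1,\,k-1\}. \] -/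

import Mathlib

open scoped Pointwise

/-!
The argument is Mineyev's. A left order on the free group `F` orders the edges of its Cayley tree
`T` invariantly. Call an edge of an ordered tree order-essential if both its ends lie in infinite
components once this edge and all larger ones are removed. Let a nontrivial finitely generated
subgroup `H` act on an `H`-cocompact subtree. Adding the edges in increasing order, the component of
a vertex first becomes infinite by means of some edge; the vertex is sent to the initial edge of its
path through that edge. This identifies the vertices with the edges that are not order-essential.
The Euler characteristic of the quotient is `1 - rank H`, so exactly `rank H - 1` orbits of edges
are order-essential.

An edge that is order-essential for the subtree of `H ∩ gKg⁻¹` is order-essential for the subtree of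
`H`, and its `g⁻¹`-translate is so for the subtree of `K`. Since `F` acts freely on `T`, the pair of
orbits obtained determines both the double coset `HgK` and the orbit of the edge under `H ∩ gKg⁻¹`.
Hence the ranks minus one add up to at most `(rank H - 1) * (rank K - 1)`.
-/

open Set MulAction

/-! ### Connected components of oriented graphs -/

/-- An oriented multigraph with vertices `V` and edges `E`. -/
structure OrientedGraph (V E : Type*) where
  src : E → V
  tgt : E → V

namespace OrientedGraph

section Connectivity

variable {V E V' E' : Type*} (Γ : OrientedGraph V E)

/-- The edge `e` has endpoints `x` and `y`, in either orientation. -/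
def Joins (e : E) (x y : V) : Prop :=
  (Γ.src e = x ∧ Γ.tgt e = y) ∨ (Γ.src e = y ∧ Γ.tgt e = x)

/-- The vertices `x` and `y` are connected by an unoriented path with edges in `P`. -/
def Joined (P : Set E) : V → V → Prop :=
  Relation.EqvGen fun x y => ∃ e ∈ P, Γ.src e = x ∧ Γ.tgt e = y

/-- The connected component of `x` in the subgraph with edge set `P`. -/
def comp (P : Set E) (x : V) : Set V := {y | Γ.Joined P x y}

/-- Every path from `x` to `y` runs through the edge `e`. -/
def Separates (e : E) (x y : V) : Prop := ¬ Γ.Joined {e}ᶜ x y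

/-- A tree is a connected graph each of whose edges separates its ends. -/
structure IsTree : Prop where
  joined : ∀ x y, Γ.Joined univ x y
  separates_ends : ∀ e, Γ.Separates e (Γ.src e) (Γ.tgt e)

/-- The edges with both ends in `A`. -/
def inducedEdges (A : Set V) : Set E := {e | Γ.src e ∈ A ∧ Γ.tgt e ∈ A}

/-- The vertex set `A` spans a connected subgraph; the empty set is allowed. -/
def IsConn (A : Set V) : Prop :=
  ∀ x ∈ A, ∀ y ∈ A, Γ.Joined (Γ.inducedEdges A) x y

variable {Γ} {Γ' : OrientedGraph V' E'} {P Q : Set E} {A B : Set V} {x y z : V} {e : E}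

theorem mem_comp : y ∈ Γ.comp P x ↔ Γ.Joined P x y := Iff.rfl

theorem joins_ends (e : E) : Γ.Joins e (Γ.src e) (Γ.tgt e) := Or.inl ⟨rfl, rfl⟩

theorem Joins.symm (h : Γ.Joins e x y) : Γ.Joins e y x := Or.symm h

theorem Joins.eq_or_eq {a b : V} (h : Γ.Joins e x y) (h' : Γ.Joins e a b) : b = x ∨ b = y := by
  rcases h with ⟨rfl, rfl⟩ | ⟨rfl, rfl⟩ <;> rcases h' with ⟨rfl, rfl⟩ | ⟨rfl, rfl⟩ <;> simp

theorem Joins.mem_inducedEdges (h : Γ.Joins e x y) (hx : x ∈ A) (hy : y ∈ A) :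
    e ∈ Γ.inducedEdges A := by
  rcases h with ⟨rfl, rfl⟩ | ⟨rfl, rfl⟩
  exacts [⟨hx, hy⟩, ⟨hy, hx⟩]

theorem Joins.notMem_inducedEdges (h : Γ.Joins e x y) (hy : y ∉ A) : e ∉ Γ.inducedEdges A := by
  rintro ⟨hs, ht⟩
  rcases h with ⟨rfl, rfl⟩ | ⟨rfl, rfl⟩
  exacts [hy ht, hy hs]

@[refl]
theorem Joined.refl (x : V) : Γ.Joined P x x := Relation.EqvGen.refl x

theorem Joined.symm (h : Γ.Joined P x y) : Γ.Joined P y x := Relation.EqvGen.symm _ _ h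

theorem Joined.trans (h : Γ.Joined P x y) (h' : Γ.Joined P y z) : Γ.Joined P x z :=
  Relation.EqvGen.trans _ _ _ h h'

theorem Joins.joined (h : Γ.Joins e x y) (he : e ∈ P) : Γ.Joined P x y := by
  rcases h with ⟨rfl, rfl⟩ | ⟨rfl, rfl⟩
  · exact Relation.EqvGen.rel _ _ ⟨e, he, rfl, rfl⟩
  · exact .symm (Relation.EqvGen.rel _ _ ⟨e, he, rfl, rfl⟩)

theorem Joined.iff_of_forall {R : V → Prop} (h : Γ.Joined P x y)
    (hR : ∀ e ∈ P, ∀ a b, Γ.Joins e a b → R a → R b) : R x ↔ R y := by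
  induction h with
  | rel x y h =>
    obtain ⟨e, he, rfl, rfl⟩ := h
    exact ⟨hR e he _ _ (joins_ends e), hR e he _ _ (joins_ends e).symm⟩
  | refl x => exact Iff.rfl
  | symm x y _ ih => exact ih.symm
  | trans x y z _ _ ih ih' => exact ih.trans ih'

theorem comp_subset {A : Set V} (hx : x ∈ A)
    (hA : ∀ e ∈ P, ∀ a b, Γ.Joins e a b → a ∈ A → b ∈ A) : Γ.comp P x ⊆ A :=
  fun _ hy => (hy.iff_of_forall hA).1 hx

theorem Joined.eq_of_forall {α : Type*} {f : V → α} (h : Γ.Joined P x y)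
    (hf : ∀ e ∈ P, f (Γ.src e) = f (Γ.tgt e)) : f x = f y := by
  refine (h.iff_of_forall (R := fun z => f x = f z) ?_).1 rfl
  rintro e he _ _ (⟨rfl, rfl⟩ | ⟨rfl, rfl⟩) h
  exacts [h.trans (hf e he), h.trans (hf e he).symm]

theorem Joined.map (f : V → V') (φ : E → E') {Q : Set E'}
    (hs : ∀ e, Γ'.src (φ e) = f (Γ.src e)) (ht : ∀ e, Γ'.tgt (φ e) = f (Γ.tgt e))
    (hφ : MapsTo φ P Q) (h : Γ.Joined P x y) : Γ'.Joined Q (f x) (f y) := by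
  refine (h.iff_of_forall (R := fun z => Γ'.Joined Q (f x) (f z)) ?_).1 (.refl _)
  rintro e he _ _ (⟨rfl, rfl⟩ | ⟨rfl, rfl⟩) h
  · exact h.trans (Joins.joined (Or.inl ⟨hs e, ht e⟩) (hφ he))
  · exact h.trans (Joins.joined (Or.inr ⟨hs e, ht e⟩) (hφ he))

theorem Joined.mono (hPQ : P ⊆ Q) (h : Γ.Joined P x y) : Γ.Joined Q x y :=
  h.map id id (fun _ => rfl) (fun _ => rfl) hPQ

theorem comp_mono (hPQ : P ⊆ Q) (x : V) : Γ.comp P x ⊆ Γ.comp Q x :=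
  fun _ h => Joined.mono hPQ h

theorem Joined.comp_eq (h : Γ.Joined P x y) : Γ.comp P x = Γ.comp P y :=
  Set.ext fun _ => ⟨h.symm.trans, h.trans⟩

theorem Joined.exists_finite (h : Γ.Joined P x y) : ∃ D : Set E, D.Finite ∧ Γ.Joined D x y := by
  refine (h.iff_of_forall (R := fun z => ∃ D : Set E, D.Finite ∧ Γ.Joined D x z) ?_).1
    ⟨∅, finite_empty, .refl x⟩
  rintro e - a b hab ⟨D, hD, h⟩
  exact ⟨insert e D, hD.insert e,
    (h.mono (subset_insert e D)).trans (hab.joined (mem_insert e D))⟩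

theorem Joined.finite_separates (h : Γ.Joined P x y) : {e | Γ.Separates e x y}.Finite := by
  obtain ⟨D, hD, h⟩ := h.exists_finite
  exact hD.subset fun e he => by_contra fun hd => he (h.mono (subset_compl_singleton_iff.2 hd))

theorem Joined.inter_inducedEdges_comp (h : Γ.Joined P x y) (hz : Γ.Joined P z x) :
    Γ.Joined (P ∩ Γ.inducedEdges (Γ.comp P z)) x y := by
  refine (h.iff_of_forall (R := fun w => Γ.Joined P z w ∧
    Γ.Joined (P ∩ Γ.inducedEdges (Γ.comp P z)) x w) ?_).1 ⟨hz, .refl x⟩ |>.2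
  rintro e he a b hab ⟨ha, ha'⟩
  have hb := ha.trans (hab.joined he)
  exact ⟨hb, ha'.trans (hab.joined ⟨he, hab.mem_inducedEdges ha hb⟩)⟩

/-- A path that leaves a set `C` of vertices does so for a last time. -/
theorem Joined.exists_exit {C : Set V} (h : Γ.Joined P x y) (hx : x ∈ C) (hy : y ∉ C) :
    ∃ e ∈ P, ∃ u ∈ C, ∃ w ∉ C, Γ.Joins e u w ∧ Γ.Joined (P ∩ Γ.inducedEdges Cᶜ) w y := by
  refine ((h.iff_of_forall (R := fun z => z ∈ C ∨ ∃ e ∈ P, ∃ u ∈ C, ∃ w ∉ C, Γ.Joins e u w ∧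
      Γ.Joined (P ∩ Γ.inducedEdges Cᶜ) w z) ?_).1 (Or.inl hx)).resolve_left hy
  intro e he a b hab ha
  rw [or_iff_not_imp_left]
  intro hb
  by_cases haC : a ∈ C
  · exact ⟨e, he, a, haC, b, hb, hab, .refl _⟩
  · obtain ⟨e', he', u, hu, w, hw, huw, hwa⟩ := ha.resolve_left haC
    exact ⟨e', he', u, hu, w, hw, huw, hwa.trans (hab.joined ⟨he, hab.mem_inducedEdges haC hb⟩)⟩

theorem Joined.avoid (h : Γ.Joined (P ∩ Γ.inducedEdges A) x y) {u v : V} (he : Γ.Joins e u v)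
    (hv : v ∉ A) : Γ.Joined {e}ᶜ x y :=
  h.mono fun _ h' h'' => he.notMem_inducedEdges hv (h'' ▸ h'.2)

theorem IsConn.joined_avoiding (hA : Γ.IsConn A) (hx : x ∈ A) (hy : y ∈ A) {u v : V}
    (he : Γ.Joins e u v) (hv : v ∉ A) : Γ.Joined {e}ᶜ x y :=
  Joined.avoid (P := univ) ((hA x hx y hy).mono (subset_inter (subset_univ _) subset_rfl)) he hv

namespace IsTree

variable (hΓ : Γ.IsTree)
include hΓ

theorem separates (h : Γ.Joins e x y) : Γ.Separates e x y := by
  rcases h with ⟨rfl, rfl⟩ | ⟨rfl, rfl⟩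
  exacts [hΓ.separates_ends e, fun h => hΓ.separates_ends e h.symm]

theorem mem_of_joined_ends (h : Γ.Joined P (Γ.src e) (Γ.tgt e)) : e ∈ P := by
  by_contra he
  exact hΓ.separates_ends e (h.mono (subset_compl_singleton_iff.2 he))

theorem joined_or_joined (h : Γ.Joins e x y) (z : V) :
    Γ.Joined {e}ᶜ x z ∨ Γ.Joined {e}ᶜ y z := by
  refine ((hΓ.joined x z).iff_of_forall
    (R := fun z => Γ.Joined {e}ᶜ x z ∨ Γ.Joined {e}ᶜ y z) ?_).1 (Or.inl (.refl x))
  intro e' _ a b hab ha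
  by_cases hee : e' = e
  · subst hee
    rcases h.eq_or_eq hab with rfl | rfl
    exacts [Or.inl (.refl _), Or.inr (.refl _)]
  · have := hab.joined (P := {e}ᶜ) hee
    exact ha.imp (·.trans this) (·.trans this)

theorem existsUnique_first_edge (hxy : x ≠ y) :
    ∃! e, (∃ u, Γ.Joins e x u) ∧ Γ.Separates e x y := by
  obtain ⟨e, -, u, rfl, w, -, huw, hwy⟩ :=
    (hΓ.joined x y).exists_exit (mem_singleton x) (fun h => hxy h.symm)
  have avoids {e' u'} (h : Γ.Joins e' u u') : Γ.Joined {e'}ᶜ w y :=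
    hwy.avoid h.symm (not_not.2 rfl)
  refine ⟨e, ⟨⟨w, huw⟩, fun h => hΓ.separates huw (h.trans (avoids huw).symm)⟩, ?_⟩
  rintro e' ⟨⟨u', he'⟩, h⟩
  by_contra hne
  exact h ((huw.joined (P := {e'}ᶜ) (Ne.symm hne)).trans (avoids he'))

theorem isConn_inter (hA : Γ.IsConn A) (hB : Γ.IsConn B) : Γ.IsConn (A ∩ B) := by
  rintro x ⟨hxA, hxB⟩ y ⟨hyA, hyB⟩
  by_contra hxy
  set C := Γ.comp (Γ.inducedEdges (A ∩ B)) x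
  have hCAB : C ⊆ A ∩ B := comp_subset ⟨hxA, hxB⟩ fun e he a b hab _ => by
    by_contra hb
    exact hab.notMem_inducedEdges hb he
  obtain ⟨e, heA, u, hu, w, hw, huw, hwy⟩ :=
    (hA x hxA y hyA).exists_exit (C := C) (.refl x) hxy
  have hwA : w ∈ A := by
    by_contra hwA
    exact huw.notMem_inducedEdges hwA heA
  have hwB : w ∉ B := fun hwB => hw (Joined.trans hu
    (huw.joined (huw.mem_inducedEdges (hCAB hu) ⟨hwA, hwB⟩)))
  exact hΓ.separates huw ((hB.joined_avoiding (hCAB hu).2 hyB huw hwB).trans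
    (hwy.avoid huw.symm (not_not.2 hu)).symm)

theorem exists_separates_of_disjoint (hA : Γ.IsConn A) (hB : Γ.IsConn B) (hAne : A.Nonempty)
    (hBne : B.Nonempty) (hAB : Disjoint A B) : ∃ e, ∀ a ∈ A, ∀ b ∈ B, Γ.Separates e a b := by
  obtain ⟨x, hx⟩ := hAne
  obtain ⟨y, hy⟩ := hBne
  obtain ⟨e, -, u, hu, w, hw, huw, hwy⟩ :=
    (hΓ.joined x y).exists_exit hx (disjoint_right.1 hAB hy)
  refine ⟨e, fun a ha b hb hab => hΓ.separates huw ?_⟩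
  have hua : Γ.Joined {e}ᶜ u a := hA.joined_avoiding hu ha huw hw
  have hby : Γ.Joined {e}ᶜ b y := hB.joined_avoiding hb hy huw.symm (disjoint_left.1 hAB hu)
  have hwy : Γ.Joined {e}ᶜ w y := hwy.avoid huw.symm (not_not.2 hu)
  exact hua.trans (hab.trans (hby.trans hwy.symm))

end IsTree

end Connectivity

section Coboundary

variable {V E : Type*} (Γ : OrientedGraph V E)

/-- The coboundary of a rational function on the vertices, a function on the edges. -/
def coboundary : (V → ℚ) →ₗ[ℚ] (E → ℚ) :=
  LinearMap.funLeft ℚ ℚ Γ.tgt - LinearMap.funLeft ℚ ℚ Γ.src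

variable {Γ}

theorem coboundary_apply (p : V → ℚ) (e : E) : Γ.coboundary p e = p (Γ.tgt e) - p (Γ.src e) := rfl

theorem Joined.eq_of_coboundary_eq_zero {p : V → ℚ} {P : Set E} {x y : V} (h : Γ.Joined P x y)
    (hp : ∀ e ∈ P, Γ.coboundary p e = 0) : p x = p y :=
  h.eq_of_forall fun e he => (sub_eq_zero.1 (hp e he)).symm

open Classical in
theorem separates_ends_of_coboundary_surjective (hΓ : Function.Surjective Γ.coboundary) (e : E) :
    Γ.Separates e (Γ.src e) (Γ.tgt e) := fun hjoin => by
  obtain ⟨p, hp⟩ := hΓ (Pi.single e 1)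
  have hsrc_tgt := hjoin.eq_of_coboundary_eq_zero fun e' he' => hp ▸ Pi.single_eq_of_ne he' _
  have he : p (Γ.tgt e) - p (Γ.src e) = 1 := by
    rw [← coboundary_apply, hp, Pi.single_eq_same]
  rw [hsrc_tgt, sub_self] at he
  exact zero_ne_one he

open Classical in
theorem IsTree.coboundary_surjective (hΓ : Γ.IsTree) : Function.Surjective Γ.coboundary := by
  intro c
  rcases isEmpty_or_nonempty V with hV | ⟨⟨v₀⟩⟩
  · exact ⟨0, funext fun e => hV.elim (Γ.src e)⟩
  let χ (e : E) (v : V) : ℚ := if Γ.Joined {e}ᶜ (Γ.tgt e) v then 1 else 0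
  have hχ {e x y} (h : Γ.Joined {e}ᶜ x y) : χ e x = χ e y :=
    if_congr ⟨(Joined.trans · h), (Joined.trans · h.symm)⟩ rfl rfl
  have hfin (v : V) : (Function.support fun e => c e * (χ e v - χ e v₀)).Finite := by
    refine (hΓ.joined v v₀).finite_separates.subset fun e he h => he ?_
    simp only [hχ h, sub_self, mul_zero]
  refine ⟨fun v => ∑ᶠ e, c e * (χ e v - χ e v₀), funext fun e => ?_⟩
  have hsrc : χ e (Γ.src e) = 0 := if_neg fun h => hΓ.separates_ends e h.symm
  have htgt : χ e (Γ.tgt e) = 1 := if_pos (.refl _)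
  rw [coboundary_apply, ← finsum_sub_distrib (hfin _) (hfin _), finsum_eq_single _ e]
  · rw [hsrc, htgt]; ring
  · intro e' he'
    rw [hχ ((joins_ends e).joined (P := {e'}ᶜ) he'.symm), sub_self]

end Coboundary

end OrientedGraph

/-! ### Orbits of group actions -/

section FreeAction

variable {G X Z : Type*} [Group G] [MulAction G X] [MulAction G Z]

theorem isOfFinOrder_of_mapsTo [IsCancelSMul G X] {g : G} {s : Set X} (hs : s.Finite)
    (hne : s.Nonempty) (hg : MapsTo (g • ·) s s) : IsOfFinOrder g := by
  obtain ⟨x, hx⟩ := hne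
  by_contra hinf
  refine Set.infinite_of_injective_forall_mem (f := fun n : ℕ => g ^ n • x)
    (fun n m h => injective_pow_iff_not_isOfFinOrder.2 hinf (IsCancelSMul.right_cancel _ _ x h))
    (fun n => ?_) hs
  simpa only [smul_iterate_apply] using hg.iterate n hx

theorem smul_eq_self_of_isOfFinOrder [LinearOrder X] [CovariantClass G X HSMul.hSMul LT.lt]
    {g : G} (hg : IsOfFinOrder g) (x : X) : g • x = x := by
  obtain ⟨n, hn, hgn⟩ := isOfFinOrder_iff_pow_eq_one.1 hg
  refine ((Function.Commute.id_left (f := (g • · : X → X))).iterate_pos_eq_iff_map_eq monotone_id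
    (smul_strictMono_right g) hn).1 ?_ |>.symm
  simp only [Function.iterate_id, id_eq, smul_iterate_apply, hgn, one_smul]

theorem finite_fiber_of_finite_orbits [IsCancelSMul G Z] [Finite (orbitRel.Quotient G X)]
    (f : X →[G] Z) (z : Z) : (f ⁻¹' {z}).Finite := by
  refine Set.Finite.of_finite_image (f := Quotient.mk (orbitRel G X))
    (Set.toFinite (α := orbitRel.Quotient G X) _) ?_
  rintro x hx y rfl hxy
  obtain ⟨g, rfl⟩ : ∃ g : G, g • y = x := Quotient.exact hxy
  have : g • f y = f y := by rwa [← map_smul]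
  rw [IsCancelSMul.eq_one_of_smul this, one_smul]

end FreeAction

section Orbits

variable {G X Z : Type*} [Group G] [MulAction G X] [MulAction G Z]

/-- The map on orbits induced by an equivariant map. -/
def mapOrbits (f : X →[G] Z) : orbitRel.Quotient G X → orbitRel.Quotient G Z :=
  Quotient.map f <| by
    rintro _ x ⟨g, rfl⟩
    exact ⟨g, (map_smul f g x).symm⟩

theorem mapOrbits_injective {f : X →[G] Z} (hf : Function.Injective f) :
    Function.Injective (mapOrbits f) := by
  rintro ⟨x⟩ ⟨y⟩ h
  obtain ⟨g, hg⟩ : ∃ g : G, g • f y = f x := Quotient.exact h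
  exact Quotient.sound ⟨g, hf ((map_smul f g y).trans hg)⟩

theorem mk_mem_range_mapOrbits {f : X →[G] Z} {z : Z} :
    Quotient.mk (orbitRel G Z) z ∈ range (mapOrbits f) ↔ z ∈ range f := by
  constructor
  · rintro ⟨⟨x⟩, h⟩
    obtain ⟨g, hg⟩ : ∃ g : G, g • z = f x := Quotient.exact h
    exact ⟨g⁻¹ • x, by rw [map_smul, ← hg, inv_smul_smul]⟩
  · rintro ⟨x, rfl⟩
    exact ⟨Quotient.mk _ x, rfl⟩

theorem card_orbits_add_card_orbits [Finite (orbitRel.Quotient G Z)] {Y : Type*} [MulAction G Y]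
    {i : X →[G] Z} {j : Y →[G] Z} (hi : Function.Injective i) (hj : Function.Injective j)
    (hij : IsCompl (range i) (range j)) :
    Nat.card (orbitRel.Quotient G X) + Nat.card (orbitRel.Quotient G Y) =
      Nat.card (orbitRel.Quotient G Z) := by
  have hcompl : IsCompl (range (mapOrbits i)) (range (mapOrbits j)) := by
    rw [← compl_eq_iff_isCompl] at hij ⊢
    ext ⟨z⟩
    exact (not_congr mk_mem_range_mapOrbits).trans
      ((Set.ext_iff.1 hij z).trans mk_mem_range_mapOrbits.symm)
  rw [← Nat.card_range_of_injective (mapOrbits_injective hi),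
    ← Nat.card_range_of_injective (mapOrbits_injective hj), ← hcompl.compl_eq,
    ← Set.ncard_add_ncard_compl (range (mapOrbits i))]
  rfl

variable {A B : SubMulAction G X}

theorem mapOrbits_inclusion_injective (h : A ≤ B) : Function.Injective
    (mapOrbits (⟨Set.inclusion h, fun _ _ => rfl⟩ : A →[G] B)) :=
  mapOrbits_injective (Set.inclusion_injective h)

theorem finite_orbits_of_le (h : A ≤ B) [Finite (orbitRel.Quotient G B)] :
    Finite (orbitRel.Quotient G A) :=
  Finite.of_injective _ (mapOrbits_inclusion_injective h)

theorem card_orbits_le_of_le (h : A ≤ B) [Finite (orbitRel.Quotient G B)] :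
    Nat.card (orbitRel.Quotient G A) ≤ Nat.card (orbitRel.Quotient G B) :=
  Nat.card_le_card_of_injective _ (mapOrbits_inclusion_injective h)

end Orbits

/-! ### Outlets and exit edges of an ordered graph -/

namespace OrientedGraph

section Action

variable {V E : Type*} (Γ : OrientedGraph V E) (G : Type*) [Group G] [MulAction G V]
  [MulAction G E]

/-- The group `G` acts by automorphisms of the oriented graph `Γ`. -/
class IsEquivariant : Prop where
  src_smul : ∀ (g : G) e, Γ.src (g • e) = g • Γ.src e
  tgt_smul : ∀ (g : G) e, Γ.tgt (g • e) = g • Γ.tgt e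

open IsEquivariant (src_smul tgt_smul)

variable {Γ G} [Γ.IsEquivariant G] {P : Set E} {x y : V} {e : E}

instance (H : Subgroup G) : Γ.IsEquivariant H where
  src_smul h e := src_smul (h : G) e
  tgt_smul h e := tgt_smul (h : G) e

theorem Joins.smul (h : Γ.Joins e x y) (g : G) : Γ.Joins (g • e) (g • x) (g • y) := by
  rcases h with ⟨rfl, rfl⟩ | ⟨rfl, rfl⟩
  exacts [Or.inl ⟨src_smul g e, tgt_smul g e⟩, Or.inr ⟨src_smul g e, tgt_smul g e⟩]

theorem Joined.smul (h : Γ.Joined P x y) (g : G) : Γ.Joined (g • P) (g • x) (g • y) :=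
  h.map (g • ·) (g • ·) (src_smul g) (tgt_smul g) fun _ => smul_mem_smul_set

theorem joined_smul_iff (g : G) : Γ.Joined (g • P) (g • x) (g • y) ↔ Γ.Joined P x y :=
  ⟨fun h => by simpa only [inv_smul_smul] using h.smul g⁻¹, (·.smul g)⟩

theorem comp_smul (g : G) (P : Set E) (x : V) : Γ.comp (g • P) (g • x) = g • Γ.comp P x := by
  ext y
  rw [mem_smul_set_iff_inv_smul_mem, mem_comp, mem_comp,
    ← joined_smul_iff (P := P) g, smul_inv_smul]

theorem separates_smul_iff (g : G) : Γ.Separates (g • e) (g • x) (g • y) ↔ Γ.Separates e x y := by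
  rw [Separates, Separates, ← smul_set_singleton, ← smul_set_compl, joined_smul_iff]

variable (Γ G) in
/-- The source map of an equivariant graph. -/
def srcHom : E →[G] V := ⟨Γ.src, src_smul⟩

variable (Γ G) in
/-- The target map of an equivariant graph. -/
def tgtHom : E →[G] V := ⟨Γ.tgt, tgt_smul⟩

variable (Γ G) in
theorem finite_incident [IsCancelSMul G V] [Finite (orbitRel.Quotient G E)] (v : V) :
    {e | ∃ u, Γ.Joins e v u}.Finite := by
  refine ((finite_fiber_of_finite_orbits (Γ.srcHom G) v).union
    (finite_fiber_of_finite_orbits (Γ.tgtHom G) v)).subset ?_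
  rintro e ⟨u, ⟨h, -⟩ | ⟨-, h⟩⟩
  exacts [Or.inl h, Or.inr h]

end Action

section Order

variable {V E V' E' : Type*} (Γ : OrientedGraph V E) {Γ' : OrientedGraph V' E'} [LinearOrder E]
  [LinearOrder E']

/-- Mineyev's order-essential edges: both ends lie in infinite components of the subgraph of
smaller edges. -/
def IsOrderEssential (e : E) : Prop :=
  (Γ.comp (Iio e) (Γ.src e)).Infinite ∧ (Γ.comp (Iio e) (Γ.tgt e)).Infinite

/-- `y` is the vertex through which the component of `v` in the subgraphs of small edges first
becomes infinite, and `τ` is the edge leading to it. -/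
structure IsOutlet (v : V) (τ : E) (y : V) : Prop where
  finite : (Γ.comp (Iio τ) v).Finite
  infinite : (Γ.comp (Iic τ) v).Infinite
  not_joined : ¬ Γ.Joined (Iio τ) v y
  exists_joins : ∃ x, Γ.Joined (Iio τ) v x ∧ Γ.Joins τ x y

/-- `e` is the first edge of the path from `v` to its outlet. -/
def IsExitEdge (v : V) (e : E) : Prop :=
  ∃ τ y, Γ.IsOutlet v τ y ∧ (∃ u, Γ.Joins e v u) ∧ Γ.Separates e v y

variable {Γ} {v w x y : V} {e τ τ' : E}

theorem IsOrderEssential.map (f : V → V') (φ : E → E') (hs : ∀ e, Γ'.src (φ e) = f (Γ.src e))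
    (ht : ∀ e, Γ'.tgt (φ e) = f (Γ.tgt e)) (hf : Function.Injective f) (hφ : StrictMono φ)
    (h : Γ.IsOrderEssential e) : Γ'.IsOrderEssential (φ e) := by
  have infinite_comp {x} (hx : (Γ.comp (Iio e) x).Infinite) :
      (Γ'.comp (Iio (φ e)) (f x)).Infinite := by
    refine (hx.image hf.injOn).mono ?_
    rintro _ ⟨y, hy, rfl⟩
    exact Joined.map f φ hs ht (fun e' he' => hφ he') hy
  exact ⟨hs e ▸ infinite_comp h.1, ht e ▸ infinite_comp h.2⟩

theorem exists_joins_finite_comp_of_not_isOrderEssential (h : ¬ Γ.IsOrderEssential e) :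
    ∃ x y, Γ.Joins e x y ∧ (Γ.comp (Iio e) x).Finite := by
  rcases not_and_or.1 h with h | h
  exacts [⟨_, _, joins_ends e, not_infinite.1 h⟩, ⟨_, _, (joins_ends e).symm, not_infinite.1 h⟩]

theorem IsTree.exists_minimal_boundary_edge (hΓ : Γ.IsTree)
    (hloc : ∀ v, {e | ∃ u, Γ.Joins e v u}.Finite) {M : Set V} (hM : M.Finite) (hne : M.Nonempty)
    (hMc : Mᶜ.Nonempty) : ∃ e, Minimal (fun e => ∃ x ∈ M, ∃ y ∉ M, Γ.Joins e x y) e := by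
  refine Set.Finite.exists_minimal (s := {e | ∃ x ∈ M, ∃ y ∉ M, Γ.Joins e x y}) ?_ ?_
  · refine (hM.biUnion fun x _ => hloc x).subset ?_
    rintro e ⟨x, hx, y, -, h⟩
    exact mem_biUnion hx ⟨y, h⟩
  · obtain ⟨x, hx⟩ := hne
    obtain ⟨y, hy⟩ := hMc
    obtain ⟨e, -, u, hu, w, hw, huw, -⟩ := (hΓ.joined x y).exists_exit hx hy
    exact ⟨e, u, hu, w, hw, huw⟩

theorem exists_isOutlet (h : (Γ.comp (Iio τ) v).Finite) (h' : (Γ.comp (Iic τ) v).Infinite) :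
    ∃ y, Γ.IsOutlet v τ y := by
  by_contra! hno
  refine h' (h.subset (comp_subset (.refl v) fun e he a b hab ha => ?_))
  rcases eq_or_lt_of_le (mem_Iic.1 he) with rfl | hlt
  · by_contra hb
    exact hno b ⟨h, h', hb, a, ha, hab⟩
  · exact Joined.trans ha (hab.joined hlt)

theorem le_of_infinite_comp_of_finite_comp (h : (Γ.comp (Iic τ) v).Infinite)
    (h' : (Γ.comp (Iio τ') v).Finite) : τ' ≤ τ :=
  le_of_not_gt fun hlt => h (h'.subset (comp_mono (Iic_subset_Iio.2 hlt) v))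

namespace IsOutlet

theorem ne (h : Γ.IsOutlet v τ y) : v ≠ y := by
  rintro rfl
  exact h.not_joined (.refl v)

theorem edge_unique (h : Γ.IsOutlet v τ x) (h' : Γ.IsOutlet v τ' y) : τ = τ' :=
  le_antisymm (le_of_infinite_comp_of_finite_comp h'.infinite h.finite)
    (le_of_infinite_comp_of_finite_comp h.infinite h'.finite)

theorem unique (h : Γ.IsOutlet v τ x) (h' : Γ.IsOutlet v τ' y) : x = y := by
  obtain rfl := h.edge_unique h'
  obtain ⟨a, -, hax⟩ := h.exists_joins
  obtain ⟨b, hb, hby⟩ := h'.exists_joins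
  refine (hby.eq_or_eq hax).resolve_left ?_
  rintro rfl
  exact h.not_joined hb

theorem congr (h : Γ.IsOutlet v τ y) (hvw : Γ.Joined (Iio τ) v w) : Γ.IsOutlet w τ y where
  finite := hvw.comp_eq ▸ h.finite
  infinite := (hvw.mono Iio_subset_Iic_self).comp_eq ▸ h.infinite
  not_joined := fun hw => h.not_joined (hvw.trans hw)
  exists_joins := h.exists_joins.imp fun _ hx => ⟨hvw.symm.trans hx.1, hx.2⟩

theorem joined (h : Γ.IsOutlet v τ y) : Γ.Joined (Iic τ) v y := by
  obtain ⟨x, hx, hxy⟩ := h.exists_joins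
  exact (hx.mono Iio_subset_Iic_self).trans (hxy.joined (le_refl τ))

theorem le_of_separates (h : Γ.IsOutlet v τ y) (he : Γ.Separates e v y) : e ≤ τ :=
  le_of_not_gt fun hlt => he (h.joined.mono fun _ he' => ne_of_lt (lt_of_le_of_lt he' hlt))

theorem eq_of_joins (h : Γ.IsOutlet v τ x) (he : Γ.Joins τ v y) : x = y := by
  obtain ⟨a, -, hax⟩ := h.exists_joins
  exact (he.eq_or_eq hax).resolve_left h.ne.symm

theorem not_joins_of_separates (hΓ : Γ.IsTree) (h : Γ.IsOutlet v τ x) (h' : Γ.IsOutlet w τ' y)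
    (hev : Γ.Separates e v x) (hew : Γ.Separates e w y) (he : e < τ) : ¬ Γ.Joins e v w := by
  intro hvw
  obtain rfl := (h.congr (hvw.joined he)).unique h'
  exact (hΓ.joined_or_joined hvw x).elim hev hew

theorem not_joins_of_finite_comp (h : Γ.IsOutlet v τ y) (hw : (Γ.comp (Iio τ) w).Finite) :
    ¬ Γ.Joins τ v w := by
  intro hvw
  refine h.infinite ((h.finite.union hw).subset
    (comp_subset (Or.inl (.refl v)) fun e he a b hab ha => ?_))
  rcases eq_or_lt_of_le (mem_Iic.1 he) with rfl | hlt
  · rcases hvw.eq_or_eq hab with rfl | rfl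
    exacts [Or.inl (.refl _), Or.inr (.refl _)]
  · exact ha.imp (Joined.trans · (hab.joined hlt)) (Joined.trans · (hab.joined hlt))

end IsOutlet

namespace IsExitEdge

variable {e' : E}

theorem eq_edge (hΓ : Γ.IsTree) (h : Γ.IsExitEdge v e) (h' : Γ.IsExitEdge v e') : e = e' := by
  obtain ⟨τ, y, hout, hinc, hsep⟩ := h
  obtain ⟨τ', y', hout', hinc', hsep'⟩ := h'
  obtain rfl := hout.unique hout'
  exact (hΓ.existsUnique_first_edge hout.ne).unique ⟨hinc, hsep⟩ ⟨hinc', hsep'⟩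

theorem eq_vertex (hΓ : Γ.IsTree) (h : Γ.IsExitEdge v e) (h' : Γ.IsExitEdge w e) : v = w := by
  obtain ⟨τ, x, hx, ⟨u, hvu⟩, hev⟩ := h
  obtain ⟨τ', y, hy, ⟨u', hwu'⟩, hew⟩ := h'
  by_contra hvw
  obtain rfl := (hvu.eq_or_eq hwu'.symm).resolve_left (Ne.symm hvw)
  rcases (hx.le_of_separates hev).lt_or_eq with hlt | rfl
  · exact hx.not_joins_of_separates hΓ hy hev hew hlt hvu
  rcases (hy.le_of_separates hew).lt_or_eq with hlt | rfl
  · exact hy.not_joins_of_separates hΓ hx hew hev hlt hvu.symm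
  · exact hx.not_joins_of_finite_comp hy.finite hvu

theorem not_isOrderEssential (h : Γ.IsExitEdge v e) : ¬ Γ.IsOrderEssential e := by
  obtain ⟨τ, y, hout, ⟨u, hvu⟩, hsep⟩ := h
  have hfin : (Γ.comp (Iio e) v).Finite :=
    hout.finite.subset (comp_mono (Iio_subset_Iio (hout.le_of_separates hsep)) v)
  rintro ⟨hs, ht⟩
  rcases hvu with ⟨rfl, -⟩ | ⟨-, rfl⟩
  exacts [hs hfin, ht hfin]

end IsExitEdge

theorem IsOutlet.exists_isExitEdge (hΓ : Γ.IsTree) (h : Γ.IsOutlet v τ y) :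
    ∃ e, Γ.IsExitEdge v e := by
  obtain ⟨e, ⟨hinc, hsep⟩, -⟩ := hΓ.existsUnique_first_edge h.ne
  exact ⟨e, τ, y, h, hinc, hsep⟩

theorem exists_isExitEdge_of_not_isOrderEssential (hΓ : Γ.IsTree)
    (hout : ∀ v, ∃ τ y, Γ.IsOutlet v τ y) (he : ¬ Γ.IsOrderEssential e) :
    ∃ v, Γ.IsExitEdge v e := by
  obtain ⟨x, y, hxy, hfin⟩ := exists_joins_finite_comp_of_not_isOrderEssential he
  obtain ⟨τ, o, ho⟩ := hout x
  rcases (le_of_infinite_comp_of_finite_comp ho.infinite hfin).eq_or_lt with rfl | hlt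
  · obtain rfl := ho.eq_of_joins hxy
    exact ⟨x, e, o, ho, ⟨o, hxy⟩, hΓ.separates hxy⟩
  · by_cases h : Γ.Joined {e}ᶜ x o
    · exact ⟨y, τ, o, ho.congr (hxy.joined hlt), ⟨x, hxy.symm⟩,
        fun h' => hΓ.separates hxy (h.trans h'.symm)⟩
    · exact ⟨x, τ, o, ho, ⟨y, hxy⟩, h⟩

end Order

end OrientedGraph

theorem smul_set_Iio {G α : Type*} [Group G] [MulAction G α] [LinearOrder α]
    [CovariantClass G α HSMul.hSMul LT.lt] (g : G) (a : α) : g • Iio a = Iio (g • a) := by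
  ext b
  rw [mem_smul_set_iff_inv_smul_mem, mem_Iio, mem_Iio,
    ← (smul_strictMono_right (α := α) g).lt_iff_lt, smul_inv_smul]

theorem smul_set_Iic {G α : Type*} [Group G] [MulAction G α] [LinearOrder α]
    [CovariantClass G α HSMul.hSMul LT.lt] (g : G) (a : α) : g • Iic a = Iic (g • a) := by
  ext b
  rw [mem_smul_set_iff_inv_smul_mem, mem_Iic, mem_Iic,
    ← (smul_strictMono_right (α := α) g).le_iff_le, smul_inv_smul]

theorem isLowerSet_smul_set {G α : Type*} [Group G] [MulAction G α] [LinearOrder α]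
    [CovariantClass G α HSMul.hSMul LT.lt] {s : Set α} (hs : IsLowerSet s) (g : G) :
    IsLowerSet (g • s) := by
  intro a b hba ha
  rw [mem_smul_set_iff_inv_smul_mem] at ha ⊢
  exact hs ((smul_strictMono_right (α := α) g⁻¹).monotone hba) ha

namespace OrientedGraph

section OrderedAction

variable {V E : Type*} {Γ : OrientedGraph V E} [LinearOrder E] {G : Type*} [Group G]
  [MulAction G V] [MulAction G E] [Γ.IsEquivariant G] [CovariantClass G E HSMul.hSMul LT.lt]
  {P : Set E} {v y : V} {e τ : E}

open IsEquivariant (src_smul tgt_smul)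

theorem comp_Iio_smul (g : G) (e : E) (v : V) :
    Γ.comp (Iio (g • e)) (g • v) = g • Γ.comp (Iio e) v := by
  rw [← smul_set_Iio, comp_smul]

theorem comp_Iic_smul (g : G) (e : E) (v : V) :
    Γ.comp (Iic (g • e)) (g • v) = g • Γ.comp (Iic e) v := by
  rw [← smul_set_Iic, comp_smul]

theorem isOrderEssential_smul_iff (g : G) :
    Γ.IsOrderEssential (g • e) ↔ Γ.IsOrderEssential e := by
  simp only [IsOrderEssential, src_smul, tgt_smul, comp_Iio_smul, infinite_smul_set]

theorem IsOutlet.smul (h : Γ.IsOutlet v τ y) (g : G) : Γ.IsOutlet (g • v) (g • τ) (g • y) where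
  finite := by
    rw [comp_Iio_smul]
    exact h.finite.smul_set
  infinite := by
    rw [comp_Iic_smul, infinite_smul_set]
    exact h.infinite
  not_joined := by
    rw [← smul_set_Iio, joined_smul_iff]
    exact h.not_joined
  exists_joins := by
    obtain ⟨x, hx, hxy⟩ := h.exists_joins
    refine ⟨g • x, ?_, hxy.smul g⟩
    rw [← smul_set_Iio, joined_smul_iff]
    exact hx

theorem IsExitEdge.smul (h : Γ.IsExitEdge v e) (g : G) : Γ.IsExitEdge (g • v) (g • e) := by
  obtain ⟨τ, y, hout, ⟨u, hvu⟩, hsep⟩ := h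
  exact ⟨g • τ, g • y, hout.smul g, ⟨g • u, hvu.smul g⟩, (separates_smul_iff g).2 hsep⟩

variable [IsCancelSMul G V]

variable (Γ G) in
/-- An element identifying two vertices of a finite component `C` maps `C` or its inverse maps `C`
into itself, hence has finite order; but it also preserves the order of the edges. -/
theorem injOn_mk_comp (hP : IsLowerSet P) (hfin : (Γ.comp P v).Finite) :
    InjOn (Quotient.mk (orbitRel G V)) (Γ.comp P v) := by
  rcases isEmpty_or_nonempty E with hE | ⟨⟨e⟩⟩
  · have hsub : Γ.comp P v ⊆ {v} := comp_subset rfl fun e => hE.elim e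
    exact (subsingleton_singleton.anti hsub).injOn _
  have eq_one {g : G} (hg : MapsTo (g • ·) (Γ.comp P v) (Γ.comp P v)) : g = 1 := by
    have := smul_eq_self_of_isOfFinOrder (isOfFinOrder_of_mapsTo hfin ⟨v, .refl v⟩ hg) e
    exact IsCancelSMul.eq_one_of_smul (x := Γ.src e) (by rw [← src_smul, this])
  intro u hu w hw huw
  obtain ⟨g, rfl⟩ : ∃ g : G, g • w = u := Quotient.exact huw
  have hcomp : Γ.comp (g • P) (g • w) = g • Γ.comp P v := by rw [comp_smul, hw.comp_eq]
  suffices g = 1 by rw [this, one_smul]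
  rcases hP.total (isLowerSet_smul_set hP g) with h | h
  · refine inv_eq_one.1 (eq_one fun z hz => ?_)
    rw [← mem_smul_set_iff_inv_smul_mem, ← hcomp]
    exact comp_mono h _ (hu.symm.trans hz)
  · refine eq_one fun z hz => hu.trans (comp_mono h _ ?_)
    rw [hcomp]
    exact smul_mem_smul_set hz

variable (Γ G) in
theorem ncard_comp_le_card_orbits [Finite (orbitRel.Quotient G V)] (hP : IsLowerSet P)
    (hfin : (Γ.comp P v).Finite) :
    (Γ.comp P v).ncard ≤ Nat.card (orbitRel.Quotient G V) := by
  rw [← (injOn_mk_comp Γ G hP hfin).ncard_image]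
  exact ncard_le_card _

variable (Γ G) in
theorem exists_isLowerSet_ncard_comp_maximal [Finite (orbitRel.Quotient G V)] (v : V) :
    ∃ P : Set E, IsLowerSet P ∧ (Γ.comp P v).Finite ∧ ∀ Q : Set E, IsLowerSet Q →
      (Γ.comp Q v).Finite → (Γ.comp Q v).ncard ≤ (Γ.comp P v).ncard := by
  set N : Set ℕ := {n | ∃ P : Set E, IsLowerSet P ∧ (Γ.comp P v).Finite ∧
    (Γ.comp P v).ncard = n}
  have hempty : Γ.comp ∅ v ⊆ {v} := comp_subset rfl fun e he => absurd he (notMem_empty e)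
  have hNne : N.Nonempty := ⟨_, ∅, isLowerSet_empty, (finite_singleton v).subset hempty, rfl⟩
  have hNbdd : BddAbove N := ⟨Nat.card (orbitRel.Quotient G V), by
    rintro _ ⟨P, hP, hfin, rfl⟩
    exact ncard_comp_le_card_orbits Γ G hP hfin⟩
  obtain ⟨P, hP, hfin, hcard⟩ := Nat.sSup_mem hNne hNbdd
  exact ⟨P, hP, hfin, fun Q hQ hQfin => hcard ▸ le_csSup hNbdd ⟨Q, hQ, hQfin, rfl⟩⟩

variable [Infinite V] [Finite (orbitRel.Quotient G V)] [Finite (orbitRel.Quotient G E)]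

variable (G) in
include G in
theorem IsTree.exists_finite_comp_Iio_infinite_comp_Iic (hΓ : Γ.IsTree) (v : V) :
    ∃ e, (Γ.comp (Iio e) v).Finite ∧ (Γ.comp (Iic e) v).Infinite := by
  obtain ⟨P, hP, hfin, hmax⟩ := exists_isLowerSet_ncard_comp_maximal Γ G v
  set M := Γ.comp P v
  obtain ⟨e, ⟨x, hx, y, hy, hxy⟩, hmin⟩ := hΓ.exists_minimal_boundary_edge
    (Γ.finite_incident G) hfin ⟨v, .refl v⟩ hfin.infinite_compl.nonempty
  have heP : e ∉ P := fun he => hy (Joined.trans hx (hxy.joined he))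
  have hPe : P ⊆ Iio e := fun e' he' => lt_of_not_ge fun h => heP (hP h he')
  have hMe : Γ.comp (Iio e) v ⊆ M := comp_subset (.refl v) fun e' he' a b hab ha => by
    by_contra hb
    exact not_le_of_gt he' (hmin ⟨a, ha, b, hb, hab⟩ (le_of_lt he'))
  refine ⟨e, hfin.subset hMe, fun hfin' => ?_⟩
  have hPe' : P ⊆ Iic e := hPe.trans Iio_subset_Iic_self
  have hyM : y ∈ Γ.comp (Iic e) v := Joined.trans (hx.mono hPe') (hxy.joined (le_refl e))
  have hlt : M ⊂ Γ.comp (Iic e) v := ⟨comp_mono hPe' v, fun h => hy (h hyM)⟩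
  exact not_le_of_gt (ncard_lt_ncard hlt hfin') (hmax _ (isLowerSet_Iic e) hfin')

theorem IsTree.exists_isExitEdge_hom (hΓ : Γ.IsTree) : ∃ f : V →[G] E,
    Function.Injective f ∧ range f = {e | Γ.IsOrderEssential e}ᶜ := by
  have hout (v : V) : ∃ τ y, Γ.IsOutlet v τ y := by
    obtain ⟨τ, h, h'⟩ := hΓ.exists_finite_comp_Iio_infinite_comp_Iic G v
    exact ⟨τ, exists_isOutlet h h'⟩
  have hexit (v : V) : ∃ e, Γ.IsExitEdge v e := by
    obtain ⟨τ, y, h⟩ := hout v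
    exact h.exists_isExitEdge hΓ
  choose f hf using hexit
  refine ⟨⟨f, fun g v => (hf (g • v)).eq_edge hΓ ((hf v).smul g)⟩,
    fun v w hvw => (hf v).eq_vertex hΓ ((show f v = f w from hvw) ▸ hf w),
    Subset.antisymm ?_ fun e he => ?_⟩
  · rintro _ ⟨v, rfl⟩
    exact (hf v).not_isOrderEssential
  · obtain ⟨v, hv⟩ := exists_isExitEdge_of_not_isOrderEssential hΓ hout he
    exact ⟨v, (hf v).eq_edge hΓ hv⟩

end OrderedAction

end OrientedGraph

/-! ### Euler characteristic -/

section InvariantFunctions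

variable (G X : Type*) [Group G] [MulAction G X]

/-- The rational functions on `X` that are constant on the orbits of `G`. -/
def invariantFunctions : Submodule ℚ (X → ℚ) where
  carrier := {p | ∀ (g : G) x, p (g • x) = p x}
  add_mem' hp hq g x := congrArg₂ (· + ·) (hp g x) (hq g x)
  zero_mem' _ _ := rfl
  smul_mem' c _ hp g x := congrArg (c • ·) (hp g x)

/-- Invariant functions are the functions on the set of orbits. -/
def invariantFunctionsEquiv :
    invariantFunctions G X ≃ₗ[ℚ] (orbitRel.Quotient G X → ℚ) where
  toFun p := Quotient.lift p.1 <| by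
    rintro _ x ⟨g, rfl⟩
    exact p.2 g x
  invFun q := ⟨fun x => q (Quotient.mk _ x), fun g _ => congrArg q (Quotient.sound ⟨g, rfl⟩)⟩
  map_add' _ _ := funext <| Quotient.ind fun _ => rfl
  map_smul' _ _ := funext <| Quotient.ind fun _ => rfl
  left_inv _ := rfl
  right_inv _ := funext <| Quotient.ind fun _ => rfl

variable [Finite (orbitRel.Quotient G X)]

instance : Module.Finite ℚ (invariantFunctions G X) :=
  Module.Finite.equiv (invariantFunctionsEquiv G X).symm

theorem finrank_invariantFunctions :
    Module.finrank ℚ (invariantFunctions G X) = Nat.card (orbitRel.Quotient G X) := by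
  have := Fintype.ofFinite (orbitRel.Quotient G X)
  rw [(invariantFunctionsEquiv G X).finrank_eq, Module.finrank_fintype_fun_eq_card,
    Nat.card_eq_fintype_card]

end InvariantFunctions

theorem exists_hom_to_group (G X : Type*) [Group G] [MulAction G X] [IsCancelSMul G X] :
    ∃ γ : X → G, ∀ (g : G) x, γ (g • x) = g * γ x := by
  have hout : ∀ x : X, ∃ g : G, g • (Quotient.mk (orbitRel G X) x).out = x := fun x =>
    (orbitRel G X).symm (Quotient.mk_out x)
  choose γ hγ using hout
  refine ⟨γ, fun g x => IsCancelSMul.right_cancel _ _ (Quotient.mk (orbitRel G X) x).out ?_⟩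
  have hgx : Quotient.mk (orbitRel G X) (g • x) = Quotient.mk _ x := Quotient.sound ⟨g, rfl⟩
  rw [mul_smul, hγ, ← hgx, hγ]

namespace OrientedGraph

section EulerCharacteristic

variable {V E G : Type*} (Γ : OrientedGraph V E) [Group G] [MulAction G V] [MulAction G E]

variable (G) in
/-- The functions on the vertices whose coboundary is invariant: these are the functions which
an element `g` of the group changes by a constant, their period at `g`. -/
def quasiInvariantFunctions : Submodule ℚ (V → ℚ) :=
  (invariantFunctions G E).comap Γ.coboundary

variable {Γ} [Γ.IsEquivariant G] {p : V → ℚ}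

theorem mem_quasiInvariantFunctions_of_forall {φ : G → ℚ} (h : ∀ g v, p (g • v) = φ g + p v) :
    p ∈ Γ.quasiInvariantFunctions G := fun g e => by
  simp only [coboundary_apply, IsEquivariant.src_smul, IsEquivariant.tgt_smul, h,
    add_sub_add_left_eq_sub]

theorem IsTree.sub_eq_sub_of_mem (hΓ : Γ.IsTree) (hp : p ∈ Γ.quasiInvariantFunctions G) (g : G)
    (v w : V) : p (g • v) - p v = p (g • w) - p w := by
  refine (hΓ.joined v w).eq_of_coboundary_eq_zero (p := fun v => p (g • v) - p v) fun e _ => ?_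
  have := hp g e
  simp only [coboundary_apply, IsEquivariant.src_smul, IsEquivariant.tgt_smul] at this ⊢
  linarith

/-- The homomorphism of periods of a quasi-invariant function on a tree. -/
def IsTree.period (hΓ : Γ.IsTree) (v₀ : V) :
    Γ.quasiInvariantFunctions G →ₗ[ℚ] (Additive G →+ ℚ) where
  toFun p := AddMonoidHom.mk' (fun g => p.1 (g.toMul • v₀) - p.1 v₀) fun g h => by
    have := hΓ.sub_eq_sub_of_mem p.2 g.toMul (h.toMul • v₀) v₀
    rw [toMul_add, mul_smul]
    linarith
  map_add' p q := AddMonoidHom.ext fun g => add_sub_add_comm _ _ _ _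
  map_smul' c p := AddMonoidHom.ext fun g => (mul_sub c _ _).symm

theorem IsTree.period_surjective [IsCancelSMul G V] (hΓ : Γ.IsTree) (v₀ : V) :
    Function.Surjective (hΓ.period (G := G) v₀) := fun φ => by
  obtain ⟨γ, hγ⟩ := exists_hom_to_group G V
  have hφ (g : G) (v : V) : φ (.ofMul (γ (g • v))) = φ (.ofMul g) + φ (.ofMul (γ v)) := by
    rw [hγ, ofMul_mul, map_add]
  refine ⟨⟨fun v => φ (.ofMul (γ v)), mem_quasiInvariantFunctions_of_forall hφ⟩, ?_⟩
  exact AddMonoidHom.ext fun g => sub_eq_of_eq_add (hφ g.toMul v₀)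

theorem IsTree.map_ker_period (hΓ : Γ.IsTree) (v₀ : V) :
    (hΓ.period (G := G) v₀).ker.map (Γ.quasiInvariantFunctions G).subtype =
      invariantFunctions G V := by
  ext p
  constructor
  · rintro ⟨p, hp, rfl⟩ g v
    refine sub_eq_zero.1 ((hΓ.sub_eq_sub_of_mem p.2 g v v₀).trans ?_)
    exact DFunLike.congr_fun hp (Additive.ofMul g)
  · intro hp
    refine ⟨⟨p, mem_quasiInvariantFunctions_of_forall (φ := 0) fun g v => ?_⟩, ?_, rfl⟩
    · rw [hp, Pi.zero_apply, zero_add]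
    · exact AddMonoidHom.ext fun g => sub_eq_zero.2 (hp g.toMul v₀)

/-- A function on the vertices of a tree is determined by its coboundary and one value. -/
noncomputable def IsTree.quasiInvariantFunctionsEquiv (hΓ : Γ.IsTree) (v₀ : V) :
    Γ.quasiInvariantFunctions G ≃ₗ[ℚ] invariantFunctions G E × ℚ :=
  LinearEquiv.ofBijective
    ((Γ.coboundary.restrict fun _ => id).prod
      (LinearMap.proj v₀ ∘ₗ (Γ.quasiInvariantFunctions G).subtype)) <| by
    constructor
    · rw [← LinearMap.ker_eq_bot, LinearMap.ker_eq_bot']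
      rintro ⟨p, hp⟩ h
      obtain ⟨hδ, hv₀⟩ := Prod.ext_iff.1 h
      refine Subtype.ext (funext fun v => ?_)
      have hconst := (hΓ.joined v v₀).eq_of_coboundary_eq_zero (p := p) fun e _ =>
        congrFun (Subtype.ext_iff.1 hδ) e
      exact hconst.trans hv₀
    · rintro ⟨⟨c, hc⟩, a⟩
      obtain ⟨p, rfl⟩ := hΓ.coboundary_surjective c
      have hshift : Γ.coboundary (fun v => p v + (a - p v₀)) = Γ.coboundary p :=
        funext fun e => add_sub_add_right_eq_sub _ _ _
      refine ⟨⟨fun v => p v + (a - p v₀), ?_⟩, Prod.ext (Subtype.ext hshift) ?_⟩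
      · rwa [quasiInvariantFunctions, Submodule.mem_comap, hshift]
      · exact add_sub_cancel _ _

variable [IsCancelSMul G V] [Nonempty V] [Finite (orbitRel.Quotient G E)]

theorem IsTree.finite_hom (hΓ : Γ.IsTree) :
    Module.Finite ℚ (Additive G →+ ℚ) := by
  have v₀ : V := Classical.arbitrary V
  have := Module.Finite.equiv (hΓ.quasiInvariantFunctionsEquiv (G := G) v₀).symm
  exact Module.Finite.of_surjective _ (hΓ.period_surjective v₀)

theorem IsTree.finrank_hom_add_card_orbits [Finite (orbitRel.Quotient G V)] (hΓ : Γ.IsTree) :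
    Module.finrank ℚ (Additive G →+ ℚ) + Nat.card (orbitRel.Quotient G V) =
      Nat.card (orbitRel.Quotient G E) + 1 := by
  have v₀ : V := Classical.arbitrary V
  have hequiv := hΓ.quasiInvariantFunctionsEquiv (G := G) v₀
  have := Module.Finite.equiv hequiv.symm
  have hker : Module.finrank ℚ (hΓ.period (G := G) v₀).ker = Nat.card (orbitRel.Quotient G V) := by
    rw [← finrank_invariantFunctions, ← hΓ.map_ker_period v₀, Submodule.finrank_map_subtype_eq]
  rw [← hker, ← finrank_top ℚ (Additive G →+ ℚ),
    ← LinearMap.range_eq_top.2 (hΓ.period_surjective (G := G) v₀),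
    LinearMap.finrank_range_add_finrank_ker, hequiv.finrank_eq, Module.finrank_prod,
    finrank_invariantFunctions, Module.finrank_self]

end EulerCharacteristic

end OrientedGraph

/-! ### Order-essential edges -/

theorem finite_orbits_closure (G : Type*) {X : Type*} [Group G] [MulAction G X] {s : Set X}
    (hs : s.Finite) : Finite (orbitRel.Quotient G (SubMulAction.closure G s)) := by
  have := hs.to_subtype
  refine Finite.of_surjective (fun x : s => Quotient.mk _ ⟨x, SubMulAction.subset_closure x.2⟩) ?_
  rintro ⟨⟨y, hy⟩⟩
  let B : SubMulAction G X :=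
    { carrier := {y | ∃ x ∈ s, x ∈ orbit G y}
      smul_mem' := by
        rintro g y ⟨x, hx, hxy⟩
        exact ⟨x, hx, by rwa [orbit_smul]⟩ }
  obtain ⟨x, hx, g, rfl⟩ := SubMulAction.mem_closure.1 hy B fun x hx => ⟨x, hx, mem_orbit_self x⟩
  exact ⟨⟨g • y, hx⟩, Quotient.sound ⟨g, rfl⟩⟩

namespace OrientedGraph

open IsEquivariant (src_smul tgt_smul)

section Induced

variable {V E : Type*} (Γ : OrientedGraph V E) {G : Type*} [Group G] [MulAction G V]
  [MulAction G E] [Γ.IsEquivariant G]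

/-- The edges of the subgraph spanned by an invariant set of vertices. -/
def edges (A : SubMulAction G V) : SubMulAction G E where
  carrier := Γ.inducedEdges A
  smul_mem' g e he :=
    ⟨by rw [src_smul]; exact A.smul_mem g he.1, by rw [tgt_smul]; exact A.smul_mem g he.2⟩

/-- The subgraph spanned by an invariant set of vertices. -/
def induce (A : SubMulAction G V) : OrientedGraph A (Γ.edges A) where
  src e := ⟨Γ.src e, e.2.1⟩
  tgt e := ⟨Γ.tgt e, e.2.2⟩

variable {Γ} {A : SubMulAction G V}

instance : (Γ.induce A).IsEquivariant G where
  src_smul g e := Subtype.ext (src_smul g e.1)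
  tgt_smul g e := Subtype.ext (tgt_smul g e.1)

theorem IsConn.joined_induce (hA : Γ.IsConn A) (x y : A) : (Γ.induce A).Joined univ x y := by
  have hstep : ∀ e ∈ Γ.inducedEdges A, ∀ a b, Γ.Joins e a b →
      (∃ ha : a ∈ A, (Γ.induce A).Joined univ x ⟨a, ha⟩) →
      ∃ hb : b ∈ A, (Γ.induce A).Joined univ x ⟨b, hb⟩ := by
    rintro e he _ _ (⟨rfl, rfl⟩ | ⟨rfl, rfl⟩) ⟨ha, h⟩
    · exact ⟨he.2, h.trans ((joins_ends (⟨e, he⟩ : Γ.edges A)).joined (mem_univ _))⟩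
    · exact ⟨he.1, h.trans ((joins_ends (⟨e, he⟩ : Γ.edges A)).symm.joined (mem_univ _))⟩
  exact (((hA x x.2 y y.2).iff_of_forall hstep).1 ⟨x.2, .refl x⟩).2

theorem IsTree.induce (hΓ : Γ.IsTree) (hA : Γ.IsConn A) : (Γ.induce A).IsTree where
  joined := hA.joined_induce
  separates_ends e h := by
    have hmaps : MapsTo Subtype.val ({e}ᶜ : Set (Γ.edges A)) {e.1}ᶜ := fun _ hne heq =>
      hne (Subtype.ext heq)
    exact hΓ.separates_ends e
      (h.map Subtype.val Subtype.val (fun _ => rfl) (fun _ => rfl) hmaps)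

theorem Joined.forall_of_closure_eq_top {P : SubMulAction G E} {T : Set G} {v : V}
    (hT : Subgroup.closure T = ⊤) (h : ∀ g ∈ T, Γ.Joined P v (g • v)) (g : G) :
    Γ.Joined P v (g • v) := by
  have smul_P (g : G) : g • (P : Set E) ⊆ P := smul_set_subset_iff.2 fun _ he => P.smul_mem g he
  induction hT ▸ Subgroup.mem_top g using Subgroup.closure_induction with
  | mem g hg => exact h g hg
  | one => exact (one_smul G v).symm ▸ .refl v
  | mul g g' _ _ hg hg' =>
    rw [mul_smul]
    exact hg.trans ((hg'.smul g).mono (smul_P g))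
  | inv g _ hg => simpa only [inv_smul_smul] using ((hg.smul g⁻¹).mono (smul_P g⁻¹)).symm

variable (G) in
theorem IsTree.exists_cofinite_subtree (hΓ : Γ.IsTree) [Nonempty V] [Group.FG G] :
    ∃ A : SubMulAction G V, (A : Set V).Nonempty ∧ Γ.IsConn A ∧
      Finite (orbitRel.Quotient G A) ∧ Finite (orbitRel.Quotient G (Γ.edges A)) := by
  have v : V := Classical.arbitrary V
  obtain ⟨T, hT⟩ := Group.FG.out (G := G)
  choose D hDfin hD using fun g : G => (hΓ.joined v (g • v)).exists_finite
  set P₀ : Set E := ⋃ g ∈ T, D g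
  have hP₀ : P₀.Finite := T.finite_toSet.biUnion fun g _ => hDfin g
  set P := SubMulAction.closure G P₀
  have hPv := Joined.forall_of_closure_eq_top (P := P) (v := v) hT fun g hg =>
    (hD g).mono ((subset_biUnion_of_mem (u := D) hg).trans SubMulAction.subset_closure)
  let A : SubMulAction G V :=
    { carrier := Γ.comp P v
      smul_mem' := fun g x hx => (hPv g).trans <|
        (Joined.smul hx g).mono (smul_set_subset_iff.2 fun _ he => P.smul_mem g he) }
  have hA : Γ.IsConn A := fun x hx y hy =>
    ((Joined.symm hx).trans hy).inter_inducedEdges_comp hx |>.mono inter_subset_right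
  set C := SubMulAction.closure G (insert v (Γ.src '' P₀ ∪ Γ.tgt '' P₀))
  have hP_le : P ≤ Γ.edges C := SubMulAction.closure_le.2 fun e he =>
    ⟨SubMulAction.subset_closure (Or.inr (Or.inl ⟨e, he, rfl⟩)),
      SubMulAction.subset_closure (Or.inr (Or.inr ⟨e, he, rfl⟩))⟩
  have hAC : A ≤ C := fun x hx => by
    refine (Joined.iff_of_forall (R := (· ∈ C)) hx ?_).1
      (SubMulAction.subset_closure (mem_insert v _))
    rintro e he _ _ (⟨rfl, rfl⟩ | ⟨rfl, rfl⟩) -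
    exacts [(hP_le he).2, (hP_le he).1]
  have hAP : Γ.edges A ≤ P := fun e he =>
    hΓ.mem_of_joined_ends ((Joined.symm he.1).trans he.2)
  have := finite_orbits_closure G (((hP₀.image Γ.src).union (hP₀.image Γ.tgt)).insert v)
  have := finite_orbits_closure G hP₀
  exact ⟨A, ⟨v, .refl v⟩, hA, finite_orbits_of_le hAC, finite_orbits_of_le hAP⟩

end Induced

section Essential

variable {V E G : Type*} {Γ : OrientedGraph V E} [LinearOrder E] [Group G] [MulAction G V]
  [MulAction G E] [Γ.IsEquivariant G] [CovariantClass G E HSMul.hSMul LT.lt]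

instance (B : SubMulAction G E) : CovariantClass G B HSMul.hSMul LT.lt :=
  ⟨fun g _ _ h => smul_strictMono_right (α := E) g h⟩

variable (Γ) in
/-- The edges which are order-essential in the subgraph spanned by `A`. -/
def essentialEdges (A : SubMulAction G V) : SubMulAction G E where
  carrier := {e | ∃ he : e ∈ Γ.edges A, (Γ.induce A).IsOrderEssential ⟨e, he⟩}
  smul_mem' g _ h := ⟨(Γ.edges A).smul_mem g h.1, (isOrderEssential_smul_iff g).2 h.2⟩

theorem essentialEdges_le (A : SubMulAction G V) : Γ.essentialEdges A ≤ Γ.edges A :=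
  fun _ he => he.1

theorem infinite_of_joined [IsCancelSMul G V] [Nontrivial G] [Nonempty V]
    (hΓ : ∀ x y, Γ.Joined univ x y) : Infinite V := by
  by_contra hV
  rw [not_infinite_iff_finite] at hV
  obtain ⟨g, hg⟩ := exists_ne (1 : G)
  have v : V := Classical.arbitrary V
  have hfix (e : E) : g • e = e := smul_eq_self_of_isOfFinOrder
    (isOfFinOrder_of_mapsTo (finite_univ (α := V)) ⟨v, mem_univ v⟩ (mapsTo_univ _ _)) e
  have hE : IsEmpty E := ⟨fun e => hg <| IsCancelSMul.eq_one_of_smul (x := Γ.src e) <| by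
    rw [← src_smul, hfix]⟩
  have hgv : g • v = v := ((hΓ v (g • v)).iff_of_forall (R := (· = v)) fun e => hE.elim e).1 rfl
  exact hg (IsCancelSMul.eq_one_of_smul hgv)

variable [IsCancelSMul G V] [Nontrivial G] {A : SubMulAction G V}
  [Finite (orbitRel.Quotient G A)] [Finite (orbitRel.Quotient G (Γ.edges A))]

theorem IsTree.card_orbits_add_card_orbits_essentialEdges (hΓ : Γ.IsTree) (hA : Γ.IsConn A)
    (hne : (A : Set V).Nonempty) :
    Nat.card (orbitRel.Quotient G A) + Nat.card (orbitRel.Quotient G (Γ.essentialEdges A)) =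
      Nat.card (orbitRel.Quotient G (Γ.edges A)) := by
  have : Nonempty A := hne.to_subtype
  have := infinite_of_joined (G := G) hA.joined_induce
  obtain ⟨f, hf, hrange⟩ := (hΓ.induce hA).exists_isExitEdge_hom (G := G)
  let j : Γ.essentialEdges A →[G] Γ.edges A :=
    ⟨Set.inclusion (essentialEdges_le A), fun _ _ => rfl⟩
  have hj : range j = {e | (Γ.induce A).IsOrderEssential e} := by
    ext e
    exact ⟨fun ⟨e', h⟩ => h ▸ e'.2.2, fun he => ⟨⟨e, e.2, he⟩, rfl⟩⟩
  refine card_orbits_add_card_orbits (j := j) hf (Set.inclusion_injective (essentialEdges_le A)) ?_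
  rw [hrange, hj]
  exact isCompl_compl.symm

theorem IsTree.finrank_hom_eq (hΓ : Γ.IsTree) (hA : Γ.IsConn A) (hne : (A : Set V).Nonempty) :
    Module.finrank ℚ (Additive G →+ ℚ) =
      Nat.card (orbitRel.Quotient G (Γ.essentialEdges A)) + 1 := by
  have : Nonempty A := hne.to_subtype
  have heuler := (hΓ.induce hA).finrank_hom_add_card_orbits (G := G)
  have hcard := hΓ.card_orbits_add_card_orbits_essentialEdges hA hne
  omega

end Essential

end OrientedGraph

/-! ### Rank of a free group -/

section Rank

variable {G S : Type*} [Group G]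

/-- Evaluation of the homomorphisms `G → ℚ` at the elements of a family `b` in `G`. -/
def evalHom (b : S → G) : (Additive G →+ ℚ) →ₗ[ℚ] (S → ℚ) where
  toFun φ x := φ (Additive.ofMul (b x))
  map_add' _ _ := rfl
  map_smul' _ _ := rfl

theorem evalHom_injective {b : S → G} (hb : Subgroup.closure (range b) = ⊤) :
    Function.Injective (evalHom b) := fun φ ψ h => by
  refine AddMonoidHom.toMultiplicativeRight.injective (MonoidHom.eq_of_eqOn_dense hb ?_)
  rintro _ ⟨x, rfl⟩
  exact congrArg Multiplicative.ofAdd (congrFun h x)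

theorem evalHom_basis_surjective (b : FreeGroupBasis S G) : Function.Surjective (evalHom b) :=
  fun c => by
    have h := b.lift.symm_apply_apply fun x => Multiplicative.ofAdd (c x)
    exact ⟨AddMonoidHom.toMultiplicativeRight.symm (b.lift fun x => Multiplicative.ofAdd (c x)),
      funext fun x => congrArg Multiplicative.toAdd (congrFun h x)⟩

theorem closure_range_basis (b : FreeGroupBasis S G) : Subgroup.closure (range b) = ⊤ := by
  rw [← FreeGroup.lift_surjective_iff_closure_range_eq_top]
  have hlift : FreeGroup.lift b = b.repr.symm.toMonoidHom :=
    FreeGroup.ext_hom _ _ fun x => FreeGroup.lift_apply_of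
  rw [hlift]
  exact b.repr.symm.surjective

theorem finrank_hom_le_rank [Group.FG G] :
    Module.finrank ℚ (Additive G →+ ℚ) ≤ Group.rank G := by
  obtain ⟨T, hcard, hT⟩ := Group.rank_spec G
  have hT' : Subgroup.closure (range ((↑) : T → G)) = ⊤ := by rwa [Subtype.range_coe]
  simpa [hcard] using LinearMap.finrank_le_finrank_of_injective (evalHom_injective hT')

theorem exists_rank_eq_finrank_hom [IsFreeGroup G] [Module.Finite ℚ (Additive G →+ ℚ)] :
    ∃ _ : Group.FG G, Group.rank G = Module.finrank ℚ (Additive G →+ ℚ) := by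
  classical
  let b := IsFreeGroup.basis G
  have hfin := Module.Finite.of_surjective _ (evalHom_basis_surjective b)
  have := (Pi.linearIndependent_single_one (IsFreeGroup.Generators G) ℚ).finite
  have := Fintype.ofFinite (IsFreeGroup.Generators G)
  have hcl : Subgroup.closure (Finset.univ.image b : Set G) = ⊤ := by
    rw [Finset.coe_image, Finset.coe_univ, image_univ, closure_range_basis]
  have hfg : Group.FG G := ⟨_, hcl⟩
  refine ⟨hfg, le_antisymm ?_ finrank_hom_le_rank⟩
  calc Group.rank G ≤ (Finset.univ.image b).card := Group.rank_le hcl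
    _ ≤ Fintype.card (IsFreeGroup.Generators G) := Finset.card_image_le
    _ = Module.finrank ℚ (IsFreeGroup.Generators G → ℚ) :=
      (Module.finrank_fintype_fun_eq_card ℚ).symm
    _ ≤ Module.finrank ℚ (Additive G →+ ℚ) :=
      LinearMap.finrank_le_finrank_of_surjective (evalHom_basis_surjective b)

end Rank

/-! ### Intersections of conjugates -/

section DoubleCosets

variable {F Z : Type*} [Group F] [MulAction F Z] {H K : Subgroup F}

theorem mem_conj_smul_iff {g x : F} : x ∈ MulAut.conj g • K ↔ g⁻¹ * x * g ∈ K := by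
  rw [Subgroup.mem_pointwise_smul_iff_inv_smul_mem, ← map_inv, MulAut.smul_def, MulAut.conj_apply,
    inv_inv]

theorem inv_smul_smul_mem {Q : SubMulAction K Z} {g l : F} {z : Z} (hl : l ∈ MulAut.conj g • K)
    (hz : g⁻¹ • z ∈ Q) : g⁻¹ • l • z ∈ Q := by
  simpa only [Subgroup.mk_smul, mul_smul, smul_inv_smul] using
    Q.smul_mem ⟨_, mem_conj_smul_iff.1 hl⟩ hz

/-- The intersection of an `H`-invariant set with the translate by `g` of a `K`-invariant set. -/
def interTranslate (P : SubMulAction H Z) (Q : SubMulAction K Z) (g : F) :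
    SubMulAction ↥(H ⊓ MulAut.conj g • K) Z where
  carrier := {z | z ∈ P ∧ g⁻¹ • z ∈ Q}
  smul_mem' l _ hz := ⟨P.smul_mem ⟨l, l.2.1⟩ hz.1, inv_smul_smul_mem l.2.2 hz.2⟩

variable (P : SubMulAction H Z) (Q : SubMulAction K Z)

/-- The `H`-orbit of `z` and the `K`-orbit of `g⁻¹ • z`, for an orbit of the intersection of `H`
with the conjugate of `K` by `g`. -/
def orbitPair (g : F) :
    orbitRel.Quotient ↥(H ⊓ MulAut.conj g • K) (interTranslate P Q g) →
      orbitRel.Quotient H P × orbitRel.Quotient K Q :=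
  Quotient.lift (fun z => (Quotient.mk _ ⟨z, z.2.1⟩, Quotient.mk _ ⟨g⁻¹ • z.1, z.2.2⟩)) <| by
    rintro _ z ⟨l, rfl⟩
    refine Prod.ext (Quotient.sound ⟨⟨l, l.2.1⟩, rfl⟩)
      (Quotient.sound ⟨⟨_, mem_conj_smul_iff.1 l.2.2⟩, Subtype.ext ?_⟩)
    change (g⁻¹ * l * g) • g⁻¹ • z.1 = g⁻¹ • l.1 • z.1
    rw [mul_smul, smul_inv_smul, mul_smul]

variable [IsCancelSMul F Z] {X : Set F}

theorem sigma_orbitPair_injective (hX : InjOn (DoubleCoset.mk H K) X) : Function.Injective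
    fun x : Σ g : X, orbitRel.Quotient ↥(H ⊓ MulAut.conj g.1 • K) (interTranslate P Q g) =>
      orbitPair P Q x.1 x.2 := by
  rintro ⟨⟨g, hg⟩, ⟨z⟩⟩ ⟨⟨g', hg'⟩, ⟨z'⟩⟩ h
  obtain ⟨⟨a, ha⟩, haz⟩ := Quotient.exact (congrArg Prod.fst h)
  obtain ⟨⟨k, hk⟩, hkz⟩ := Quotient.exact (congrArg Prod.snd h)
  have haz : a • z'.1 = z.1 := congrArg Subtype.val haz
  have hkz : k • g'⁻¹ • z'.1 = g⁻¹ • z.1 := congrArg Subtype.val hkz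
  obtain rfl : a = g * k * g'⁻¹ := by
    refine IsCancelSMul.right_cancel _ _ z'.1 ?_
    rw [haz, mul_smul, mul_smul, hkz, smul_inv_smul]
  obtain rfl : g = g' := by
    refine hX hg hg' ((DoubleCoset.eq H K g g').2 ⟨_, inv_mem ha, k, hk, ?_⟩)
    group
  refine congrArg (Sigma.mk _) (Quotient.sound ⟨⟨g * k * g⁻¹, ha, ?_⟩, Subtype.ext haz⟩)
  exact Subgroup.smul_mem_pointwise_smul k (MulAut.conj g) K hk

variable [Finite (orbitRel.Quotient H P)] [Finite (orbitRel.Quotient K Q)]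

theorem finite_orbits_interTranslate (g : F) :
    Finite (orbitRel.Quotient ↥(H ⊓ MulAut.conj g • K) (interTranslate P Q g)) := by
  refine .of_injective (orbitPair P Q g) fun q q' h => ?_
  have h' := sigma_orbitPair_injective P Q (injOn_singleton _ g) (a₁ := ⟨⟨g, rfl⟩, q⟩)
    (a₂ := ⟨⟨g, rfl⟩, q'⟩) h
  exact eq_of_heq (Sigma.mk.inj h').2

theorem finite_setOf_nonempty_interTranslate (hX : InjOn (DoubleCoset.mk H K) X) :
    {g ∈ X | (interTranslate P Q g : Set Z).Nonempty}.Finite := by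
  have hinj := sigma_orbitPair_injective P Q (hX.mono (sep_subset X fun g =>
    (interTranslate P Q g : Set Z).Nonempty))
  exact Finite.of_injective _ (hinj.comp (f := fun g => ⟨g, Quotient.mk _ ⟨_, g.2.2.some_mem⟩⟩)
    fun g g' h => congrArg Sigma.fst h)

theorem sum_card_orbits_interTranslate_le {Y : Finset F} (hY : InjOn (DoubleCoset.mk H K) Y) :
    ∑ g ∈ Y, Nat.card (orbitRel.Quotient ↥(H ⊓ MulAut.conj g • K) (interTranslate P Q g)) ≤
      Nat.card (orbitRel.Quotient H P) * Nat.card (orbitRel.Quotient K Q) := by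
  have := finite_orbits_interTranslate P Q
  rw [← Nat.card_prod, ← Finset.sum_coe_sort, ← Nat.card_sigma]
  exact Nat.card_le_card_of_injective _ (sigma_orbitPair_injective P Q hY)

end DoubleCosets

namespace OrientedGraph

open IsEquivariant (src_smul tgt_smul)

section Intersections

variable {V E F : Type*} {Γ : OrientedGraph V E} [Group F] [MulAction F V] [MulAction F E]
  [Γ.IsEquivariant F] {H K : Subgroup F} {A : SubMulAction H V} {B : SubMulAction K V}

theorem isCancelSMul_edges (Γ : OrientedGraph V E) [Γ.IsEquivariant F] [IsCancelSMul F V] :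
    IsCancelSMul F E where
  left_cancel' g _ _ h := MulAction.injective g h
  right_cancel' g g' e h := IsCancelSMul.right_cancel g g' (Γ.src e) <| by
    rw [← src_smul, h, src_smul]

theorem edges_interTranslate_le (g : F) :
    Γ.edges (interTranslate A B g) ≤ interTranslate (Γ.edges A) (Γ.edges B) g := fun e he =>
  ⟨⟨he.1.1, he.2.1⟩, by rw [src_smul]; exact he.1.2, by rw [tgt_smul]; exact he.2.2⟩

theorem IsConn.smul {A : Set V} (hA : Γ.IsConn A) (g : F) : Γ.IsConn (g • A) := by
  rintro _ ⟨x, hx, rfl⟩ _ ⟨y, hy, rfl⟩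
  refine ((hA x hx y hy).smul g).mono ?_
  rintro _ ⟨e, he, rfl⟩
  exact ⟨by rw [src_smul]; exact smul_mem_smul_set he.1,
    by rw [tgt_smul]; exact smul_mem_smul_set he.2⟩

theorem IsTree.isConn_interTranslate (hΓ : Γ.IsTree) (hA : Γ.IsConn A) (hB : Γ.IsConn B) (g : F) :
    Γ.IsConn (interTranslate A B g) := by
  convert hΓ.isConn_inter hA (hB.smul g) using 1
  ext x
  rw [mem_inter_iff, mem_smul_set_iff_inv_smul_mem]
  rfl

variable [LinearOrder E] [CovariantClass F E HSMul.hSMul LT.lt]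

instance covariantClass_subgroup (H : Subgroup F) : CovariantClass H E HSMul.hSMul LT.lt :=
  ⟨fun h _ _ hlt => smul_strictMono_right (α := E) (h : F) hlt⟩

theorem essentialEdges_interTranslate_le (g : F) :
    Γ.essentialEdges (interTranslate A B g) ≤
      interTranslate (Γ.essentialEdges A) (Γ.essentialEdges B) g := by
  rintro e ⟨he, hess⟩
  obtain ⟨heA, heB⟩ := edges_interTranslate_le g he
  refine ⟨⟨heA, ?_⟩, heB, ?_⟩
  · exact hess.map (Γ' := Γ.induce A) (fun x : ↥(interTranslate A B g) => ⟨x, x.2.1⟩)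
      (fun e : ↥(Γ.edges (interTranslate A B g)) => ⟨e, (edges_interTranslate_le g e.2).1⟩)
      (fun _ => rfl) (fun _ => rfl)
      (fun _ _ h => Subtype.ext (Subtype.mk.inj h)) fun _ _ h => h
  · exact hess.map (Γ' := Γ.induce B) (fun x : ↥(interTranslate A B g) => ⟨g⁻¹ • x.1, x.2.2⟩)
      (fun e : ↥(Γ.edges (interTranslate A B g)) =>
        ⟨g⁻¹ • e.1, (edges_interTranslate_le g e.2).2⟩)
      (fun e => Subtype.ext (src_smul g⁻¹ e.1)) (fun e => Subtype.ext (tgt_smul g⁻¹ e.1))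
      (fun _ _ h => Subtype.ext (MulAction.injective g⁻¹ (Subtype.mk.inj h)))
      fun _ _ h => smul_strictMono_right (α := E) g⁻¹ h

theorem sum_card_orbits_essentialEdges_interTranslate_le [IsCancelSMul F V]
    [Finite (orbitRel.Quotient H (Γ.edges A))] [Finite (orbitRel.Quotient K (Γ.edges B))]
    {Y : Finset F} (hY : InjOn (DoubleCoset.mk H K) Y) :
    ∑ g ∈ Y, Nat.card (orbitRel.Quotient ↥(H ⊓ MulAut.conj g • K)
        (Γ.essentialEdges (interTranslate A B g))) ≤
      Nat.card (orbitRel.Quotient H (Γ.essentialEdges A)) *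
        Nat.card (orbitRel.Quotient K (Γ.essentialEdges B)) := by
  have : IsCancelSMul F E := isCancelSMul_edges Γ
  have := finite_orbits_of_le (Γ.essentialEdges_le A)
  have := finite_orbits_of_le (Γ.essentialEdges_le B)
  have := finite_orbits_interTranslate (Γ.essentialEdges A) (Γ.essentialEdges B)
  refine (Finset.sum_le_sum fun g _ => ?_).trans
    (sum_card_orbits_interTranslate_le (Γ.essentialEdges A) (Γ.essentialEdges B) hY)
  exact card_orbits_le_of_le (essentialEdges_interTranslate_le g)

/-- Otherwise the edges separating `A` from the translate of `B` would form a nonempty finite set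
stable under the intersection of the two groups. -/
theorem IsTree.interTranslate_nonempty [IsCancelSMul F V] (hΓ : Γ.IsTree) (hA : Γ.IsConn A)
    (hB : Γ.IsConn B) (hAne : (A : Set V).Nonempty) (hBne : (B : Set V).Nonempty) {g : F}
    (hg : H ⊓ MulAut.conj g • K ≠ ⊥) : (interTranslate A B g : Set V).Nonempty := by
  by_contra hempty
  have hdisj : Disjoint (A : Set V) (g • (B : Set V)) := disjoint_left.2 fun x hx hx' =>
    hempty ⟨x, hx, mem_smul_set_iff_inv_smul_mem.1 hx'⟩
  have hsep := hΓ.exists_separates_of_disjoint hA (hB.smul g) hAne (hBne.smul_set) hdisj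
  set D := {e | ∀ x ∈ (A : Set V), ∀ y ∈ g • (B : Set V), Γ.Separates e x y}
  have hD : D.Finite := by
    obtain ⟨⟨x, hx⟩, ⟨y, hy⟩⟩ := And.intro hAne (hBne.smul_set (a := g))
    exact (hΓ.joined x y).finite_separates.subset fun e he => he x hx y hy
  obtain ⟨⟨l, hlH, hlK⟩, hl⟩ := Subgroup.ne_bot_iff_exists_ne_one.1 hg
  have hlD : MapsTo (l • ·) D D := fun e he x hx y hy => by
    rw [← smul_inv_smul l x, ← smul_inv_smul l y, separates_smul_iff]
    refine he _ (A.smul_mem ⟨_, inv_mem hlH⟩ hx) _ ?_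
    rw [mem_smul_set_iff_inv_smul_mem] at hy ⊢
    exact inv_smul_smul_mem (inv_mem hlK) hy
  have : IsCancelSMul F E := isCancelSMul_edges Γ
  obtain ⟨e, he⟩ := hsep
  have hfix := smul_eq_self_of_isOfFinOrder (isOfFinOrder_of_mapsTo hD ⟨e, he⟩ hlD) e
  exact hl (Subtype.ext (IsCancelSMul.eq_one_of_smul hfix))

end Intersections

section HannaNeumann

variable {V E F : Type*} {Γ : OrientedGraph V E} [LinearOrder E] [Group F] [MulAction F V]
  [MulAction F E] [Γ.IsEquivariant F] [CovariantClass F E HSMul.hSMul LT.lt] [IsCancelSMul F V]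
  [IsFreeGroup F]

theorem IsTree.exists_rank_eq_card_orbits [Nontrivial F] (hΓ : Γ.IsTree) {A : SubMulAction F V}
    (hA : Γ.IsConn A) (hne : (A : Set V).Nonempty) [Finite (orbitRel.Quotient F A)]
    [Finite (orbitRel.Quotient F (Γ.edges A))] :
    ∃ _ : Group.FG F, Group.rank F = Nat.card (orbitRel.Quotient F (Γ.essentialEdges A)) + 1 := by
  have : Nonempty A := hne.to_subtype
  have := (hΓ.induce hA).finite_hom (G := F)
  obtain ⟨hfg, hrank⟩ := exists_rank_eq_finrank_hom (G := F)
  exact ⟨hfg, hrank.trans (hΓ.finrank_hom_eq hA hne)⟩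

theorem IsTree.exists_rank_interTranslate_eq (hΓ : Γ.IsTree) {H K : Subgroup F}
    {A : SubMulAction H V} {B : SubMulAction K V} (hA : Γ.IsConn A) (hB : Γ.IsConn B)
    (hAne : (A : Set V).Nonempty) (hBne : (B : Set V).Nonempty) [Finite (orbitRel.Quotient H A)]
    [Finite (orbitRel.Quotient K B)] [Finite (orbitRel.Quotient H (Γ.edges A))]
    [Finite (orbitRel.Quotient K (Γ.edges B))] {g : F} (hg : H ⊓ MulAut.conj g • K ≠ ⊥) :
    ∃ _ : Group.FG ↥(H ⊓ MulAut.conj g • K), Group.rank ↥(H ⊓ MulAut.conj g • K) =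
      Nat.card (orbitRel.Quotient ↥(H ⊓ MulAut.conj g • K)
        (Γ.essentialEdges (interTranslate A B g))) + 1 := by
  have : IsCancelSMul F E := isCancelSMul_edges Γ
  have := finite_orbits_interTranslate A B g
  have := finite_orbits_interTranslate (Γ.edges A) (Γ.edges B) g
  have := finite_orbits_of_le (edges_interTranslate_le (Γ := Γ) (A := A) (B := B) g)
  have := (Subgroup.nontrivial_iff_ne_bot _).2 hg
  exact hΓ.exists_rank_eq_card_orbits (hΓ.isConn_interTranslate hA hB g)
    (hΓ.interTranslate_nonempty hA hB hAne hBne hg)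

theorem IsTree.hanna_neumann [Nonempty V] (hΓ : Γ.IsTree) (H K : Subgroup F) [Group.FG H]
    [Group.FG K] (hH : H ≠ ⊥) (hK : K ≠ ⊥) :
    ∃ _ : ∀ g : F, Group.FG ↥(H ⊓ MulAut.conj g • K),
      ∀ X : Set F, InjOn (DoubleCoset.mk H K) X →
        ∃ hY : {g ∈ X | H ⊓ MulAut.conj g • K ≠ ⊥}.Finite,
          ∑ g ∈ hY.toFinset, ((Group.rank ↥(H ⊓ MulAut.conj g • K) : ℤ) - 1) ≤
            ((Group.rank H : ℤ) - 1) * ((Group.rank K : ℤ) - 1) := by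
  obtain ⟨A, hAne, hA, _, _⟩ := hΓ.exists_cofinite_subtree H
  obtain ⟨B, hBne, hB, _, _⟩ := hΓ.exists_cofinite_subtree K
  have hrank (g : F) (hg : H ⊓ MulAut.conj g • K ≠ ⊥) :=
    hΓ.exists_rank_interTranslate_eq hA hB hAne hBne hg
  have hfg (g : F) : Group.FG ↥(H ⊓ MulAut.conj g • K) := by
    by_cases hg : H ⊓ MulAut.conj g • K = ⊥
    · exact hg ▸ inferInstance
    · exact (hrank g hg).1
  refine ⟨hfg, fun X hX => ?_⟩
  have hY : {g ∈ X | H ⊓ MulAut.conj g • K ≠ ⊥}.Finite :=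
    (finite_setOf_nonempty_interTranslate A B hX).subset fun g hg =>
      ⟨hg.1, hΓ.interTranslate_nonempty hA hB hAne hBne hg.2⟩
  refine ⟨hY, ?_⟩
  have := (Subgroup.nontrivial_iff_ne_bot _).2 hH
  have := (Subgroup.nontrivial_iff_ne_bot _).2 hK
  obtain ⟨_, hrankH⟩ := hΓ.exists_rank_eq_card_orbits hA hAne
  obtain ⟨_, hrankK⟩ := hΓ.exists_rank_eq_card_orbits hB hBne
  have hinj : InjOn (DoubleCoset.mk H K) hY.toFinset :=
    hX.mono fun g hg => (hY.mem_toFinset.1 hg).1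
  have hsum := sum_card_orbits_essentialEdges_interTranslate_le (Γ := Γ) (A := A) (B := B)
    hinj
  have hrank_sub_one : ∀ g ∈ hY.toFinset, (Group.rank ↥(H ⊓ MulAut.conj g • K) : ℤ) - 1 =
      Nat.card (orbitRel.Quotient ↥(H ⊓ MulAut.conj g • K)
        (Γ.essentialEdges (interTranslate A B g))) := fun g hg => by
    rw [(hrank g (hY.mem_toFinset.1 hg).2).2, Nat.cast_succ, add_sub_cancel_right]
  rw [hrankH, hrankK, Finset.sum_congr rfl hrank_sub_one]
  push_cast
  rw [add_sub_cancel_right, add_sub_cancel_right]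
  exact_mod_cast hsum

end HannaNeumann

end OrientedGraph

/-! ### Left orders on free groups -/

section LeftOrder

open FreeGroup

variable {G S : Type*} [Group G]

theorem exists_linearOrder_of_abs_mul_sub_sub_le (w : G → ℤ) (hne : ∀ x, x ≠ 1 → w x ≠ 0)
    (hinv : ∀ x, w x⁻¹ = -w x) (hmul : ∀ x y, |w (x * y) - w x - w y| ≤ 1) :
    ∃ _ : LinearOrder G, MulLeftStrictMono G := by
  classical
  have inv_inv_mul (x y : G) : w (y⁻¹ * x) = -w (x⁻¹ * y) := by
    rw [← hinv, mul_inv_rev, inv_inv]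
  let r (x y : G) : Prop := 0 < w (x⁻¹ * y)
  have : IsStrictTotalOrder G r :=
    { irrefl := fun x (hx : 0 < w (x⁻¹ * x)) => by
        have := inv_inv_mul x x
        omega
      trans := fun x y z (hxy : 0 < w (x⁻¹ * y)) (hyz : 0 < w (y⁻¹ * z)) => by
        have h := (abs_le.1 (hmul (x⁻¹ * y) (y⁻¹ * z))).1
        rw [mul_assoc, mul_inv_cancel_left] at h
        change 0 < w (x⁻¹ * z)
        omega
      trichotomous := fun x y (hxy : ¬ 0 < w (x⁻¹ * y)) (hyx : ¬ 0 < w (y⁻¹ * x)) => by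
        rw [inv_inv_mul] at hyx
        by_contra h
        exact hne (x⁻¹ * y) (h ∘ inv_mul_eq_one.1) (by omega) }
  refine ⟨linearOrderOfSTO r, ⟨fun g x y (h : 0 < w (x⁻¹ * y)) => ?_⟩⟩
  change 0 < w ((g * x)⁻¹ * (g * y))
  rwa [mul_inv_rev, mul_assoc, inv_mul_cancel_left]

variable [LinearOrder S]

/-- The sign of the comparison of two elements of a linear order: `1` if `a < b`, `0` if `a = b`,
and `-1` if `b < a`. -/
def compareSign {α : Type*} [LinearOrder α] (a b : α) : ℤ :=
  if a < b then 1 else if b < a then -1 else 0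

theorem neg_compareSign {α : Type*} [LinearOrder α] (a b : α) :
    -compareSign a b = compareSign b a := by
  unfold compareSign
  split_ifs <;> first | rfl | order

theorem abs_compareSign_le {α : Type*} [LinearOrder α] (a b : α) : |compareSign a b| ≤ 1 := by
  unfold compareSign
  split_ifs <;> decide

theorem odd_compareSign {α : Type*} [LinearOrder α] {a b : α} (h : a ≠ b) :
    Odd (compareSign a b) := by
  unfold compareSign
  split_ifs <;> first | decide | order

theorem abs_compareSign_sub_sub_le {α : Type*} [LinearOrder α] (a b c : α) :
    |compareSign a c - compareSign a b - compareSign b c| ≤ 1 := by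
  unfold compareSign
  split_ifs <;> first | decide | order

/-- The comparison of the first letters of two words, seen as paths in the Cayley tree leaving the
same vertex; it is `0` if one of the words is empty. -/
def branchSign (u v : List (S × Bool)) : ℤ :=
  match u.head?, v.head? with
  | some x, some y => compareSign (toLex x) (toLex y)
  | _, _ => 0

/-- The weight of a word: the number of its letters counted with their exponents, plus the signs of
the turns it makes between consecutive letters. -/
def wordWeight : List (S × Bool) → ℤ
  | [] => 0
  | x :: u => (if x.2 then 1 else -1) + branchSign (invRev [x]) u + wordWeight u

theorem branchSign_nil_left (v : List (S × Bool)) : branchSign [] v = 0 := rfl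

theorem branchSign_nil_right (u : List (S × Bool)) : branchSign u [] = 0 := by
  cases u <;> rfl

theorem branchSign_append_left {u : List (S × Bool)} (hu : u ≠ []) (v w : List (S × Bool)) :
    branchSign (u ++ v) w = branchSign u w := by
  unfold branchSign
  rw [List.head?_append_of_ne_nil _ hu]

theorem neg_branchSign (u v : List (S × Bool)) : -branchSign u v = branchSign v u := by
  rcases u with _ | ⟨x, u⟩
  · rw [branchSign_nil_left, branchSign_nil_right, neg_zero]
  rcases v with _ | ⟨y, _⟩
  · rw [branchSign_nil_left, branchSign_nil_right, neg_zero]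
  · exact neg_compareSign _ _

theorem abs_branchSign_le (u v : List (S × Bool)) : |branchSign u v| ≤ 1 := by
  unfold branchSign
  split
  · exact abs_compareSign_le _ _
  · decide

theorem abs_branchSign_sub_sub_le (u v w : List (S × Bool)) :
    |branchSign u w - branchSign u v - branchSign v w| ≤ 1 := by
  rcases u with _ | ⟨x, u⟩
  · simpa [branchSign_nil_left] using abs_branchSign_le v w
  rcases v with _ | ⟨y, v⟩
  · simpa [branchSign_nil_left, branchSign_nil_right] using abs_branchSign_le (x :: u) w
  rcases w with _ | ⟨z, _⟩
  · simpa [branchSign_nil_right] using abs_branchSign_le (x :: u) (y :: v)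
  exact abs_compareSign_sub_sub_le _ _ _

theorem wordWeight_append (u v : List (S × Bool)) :
    wordWeight (u ++ v) = wordWeight u + wordWeight v + branchSign (invRev u) v := by
  induction u with
  | nil => simp only [List.nil_append, wordWeight, invRev_empty, branchSign_nil_left]; ring
  | cons x u ih =>
    rw [List.cons_append, wordWeight, ih, wordWeight]
    rcases u with _ | ⟨y, u⟩
    · simp only [List.nil_append, invRev_empty, branchSign_nil_left, branchSign_nil_right]
      ring
    · have hne : invRev (y :: u) ≠ [] := by simp [invRev]
      rw [invRev_cons (a := x) (L := y :: u), branchSign_append_left hne, List.cons_append,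
        show branchSign (invRev [x]) (y :: (u ++ v)) = branchSign (invRev [x]) (y :: u) from rfl]
      ring

theorem wordWeight_invRev (u : List (S × Bool)) : wordWeight (invRev u) = -wordWeight u := by
  induction u with
  | nil => rfl
  | cons x u ih =>
    have hx : wordWeight (invRev [x]) = -(if x.2 then 1 else -1) := by
      rcases x with ⟨s, _ | _⟩ <;> rfl
    rw [invRev_cons, wordWeight_append, ih, hx, invRev_invRev, ← neg_branchSign, wordWeight]
    ring

theorem odd_wordWeight {u : List (S × Bool)} (hu : IsReduced u) (hne : u ≠ []) :
    Odd (wordWeight u) := by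
  induction u with
  | nil => exact absurd rfl hne
  | cons x u ih =>
    have hx : Odd (if x.2 then 1 else -1 : ℤ) := by split_ifs <;> decide
    rcases u with _ | ⟨y, u⟩
    · simpa [wordWeight, branchSign_nil_right] using hx
    obtain ⟨hxy, hu⟩ := isReduced_cons_cons.1 hu
    have hturn : (x.1, !x.2) ≠ y := by
      rintro rfl
      exact (Bool.eq_not_self _).1 (hxy rfl)
    exact (hx.add_odd (odd_compareSign (toLex.injective.ne hturn))).add_odd (ih hu (by simp))

omit [LinearOrder S] in
theorem exists_eq_append_invRev_append {u v : List (S × Bool)} (hu : IsReduced u)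
    (hv : IsReduced v) : ∃ a b c, u = a ++ c ∧ v = invRev c ++ b ∧ IsReduced (a ++ b) := by
  induction u using List.reverseRecOn generalizing v with
  | nil => exact ⟨[], v, [], rfl, rfl, hv⟩
  | append_singleton u x ih =>
    rcases v with _ | ⟨y, v⟩
    · exact ⟨u ++ [x], [], [], by simp, rfl, by simpa using hu⟩
    by_cases hxy : y = (x.1, !x.2)
    · obtain ⟨a, b, c, rfl, rfl, hab⟩ := ih (List.isChain_append.1 hu).1 hv.tail
      exact ⟨a, b, c ++ [x], by simp, by simp [invRev, hxy], hab⟩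
    · refine ⟨u ++ [x], y :: v, [], by simp, rfl, List.isChain_append.2 ⟨hu, hv, ?_⟩⟩
      simp only [List.getLast?_concat, List.head?_cons, Option.mem_def, Option.some.injEq]
      rintro _ rfl _ rfl hfst
      by_contra hsnd
      exact hxy (Prod.ext hfst.symm (Bool.eq_not_of_ne (Ne.symm hsnd)))

/-- The three paths leaving the branching point of the tripod spanned by `1`, `x` and `x * y` are
compared pairwise, and everything else cancels. -/
theorem abs_wordWeight_mul_sub_sub_le (x y : FreeGroup S) :
    |wordWeight (x * y).toWord - wordWeight x.toWord - wordWeight y.toWord| ≤ 1 := by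
  obtain ⟨a, b, c, hx, hy, hab⟩ := exists_eq_append_invRev_append (isReduced_toWord (x := x))
    (isReduced_toWord (x := y))
  have hxy : (x * y).toWord = a ++ b := by
    have : x * y = mk (a ++ b) := by
      rw [← mk_toWord (x := x), ← mk_toWord (x := y), hx, hy, ← mul_mk, ← mul_mk, ← mul_mk,
        ← inv_mk]
      group
    rw [this, toWord_mk, hab.reduce_eq]
  rw [hxy, hx, hy]
  convert abs_branchSign_sub_sub_le (invRev a) c b using 2
  rw [wordWeight_append, wordWeight_append, wordWeight_append, wordWeight_invRev, invRev_invRev]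
  ring

theorem exists_linearOrder_mulLeftStrictMono (b : FreeGroupBasis S G) :
    ∃ _ : LinearOrder G, MulLeftStrictMono G := by
  refine exists_linearOrder_of_abs_mul_sub_sub_le (fun x => wordWeight (b.repr x).toWord)
    (fun x hx hzero => ?_) (fun x => ?_) fun x y => ?_
  · have hodd := odd_wordWeight (isReduced_toWord (x := b.repr x)) fun h =>
      hx (b.repr.map_eq_one_iff.1 (toWord_eq_nil_iff.1 h))
    exact Int.not_odd_zero (hzero ▸ hodd)
  · rw [_root_.map_inv, toWord_inv, wordWeight_invRev]
  · rw [_root_.map_mul]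
    exact abs_wordWeight_mul_sub_sub_le (b.repr x) (b.repr y)

end LeftOrder

/-! ### Cayley trees -/

namespace OrientedGraph

/-- The edges of the Cayley graph of `F` with respect to a family of elements indexed by `S`. -/
@[ext]
structure CayleyEdge (F S : Type*) where
  /-- The vertex at which the edge starts. -/
  base : F
  /-- The index of the generator labelling the edge. -/
  label : S

section CayleyGraph

variable {F S : Type*} [Group F]

/-- The Cayley graph of `F` with respect to the family `b`: the edge at `g` labelled `i` goes from
`g` to `g * b i`. -/
def cayleyGraph (b : S → F) : OrientedGraph F (CayleyEdge F S) where
  src e := e.base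
  tgt e := e.base * b e.label

instance : MulAction F (CayleyEdge F S) where
  smul g e := ⟨g * e.base, e.label⟩
  one_smul e := CayleyEdge.ext (one_mul e.base) rfl
  mul_smul g h e := CayleyEdge.ext (mul_assoc g h e.base) rfl

instance (b : S → F) : (cayleyGraph b).IsEquivariant F where
  src_smul _ _ := rfl
  tgt_smul g e := mul_assoc g e.base (b e.label)

instance [LinearOrder F] [LinearOrder S] : LinearOrder (CayleyEdge F S) :=
  .lift' (fun e => toLex (e.base, e.label)) fun e e' h => by
    obtain ⟨hbase, hlabel⟩ := Prod.mk.inj (toLex.injective h)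
    exact CayleyEdge.ext hbase hlabel

instance [LinearOrder F] [MulLeftStrictMono F] [LinearOrder S] :
    CovariantClass F (CayleyEdge F S) HSMul.hSMul LT.lt where
  elim g _ _ h := Prod.Lex.toLex_lt_toLex.2 <|
    (Prod.Lex.toLex_lt_toLex.1 h).imp (mul_lt_mul_right · g) fun ⟨hbase, hlabel⟩ =>
      ⟨congrArg (g * ·) hbase, hlabel⟩

theorem joined_cayleyGraph {b : S → F} (hb : Subgroup.closure (range b) = ⊤) (x y : F) :
    (cayleyGraph b).Joined univ x y := by
  have joined_one (g : F) : (cayleyGraph b).Joined univ 1 g := by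
    rw [← mul_one g, ← smul_eq_mul]
    refine Joined.forall_of_closure_eq_top (P := ⊤) hb ?_ g
    rintro _ ⟨i, rfl⟩
    have h : (cayleyGraph b).Joined univ 1 (1 * b i) :=
      (joins_ends (Γ := cayleyGraph b) ⟨1, i⟩).joined (mem_univ _)
    rwa [one_mul, ← mul_one (b i)] at h
  exact (joined_one x).symm.trans (joined_one y)

/-- A function on the edges amounts to a homomorphism from the free group `F` to the wreath product
of `ℚ` with `F` lifting the identity of `F`, and the potential is read off its values. -/
theorem coboundary_cayleyGraph_surjective (b : FreeGroupBasis S F) :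
    Function.Surjective (cayleyGraph b).coboundary := fun c => by
  let Φ : F →* Multiplicative ℚ ≀ᵣ F :=
    b.lift fun i => ⟨fun x => Multiplicative.ofAdd (c ⟨x⁻¹, i⟩), b i⟩
  have hΦ (i : S) : Φ (b i) = ⟨fun x => Multiplicative.ofAdd (c ⟨x⁻¹, i⟩), b i⟩ :=
    congrFun (b.lift.symm_apply_apply _) i
  have hright : RegularWreathProduct.rightHom.comp Φ = .id F :=
    b.ext_hom _ _ fun i => congrArg RegularWreathProduct.right (hΦ i)
  refine ⟨fun g => ((Φ g).left 1).toAdd, funext fun e => ?_⟩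
  have hbase : (Φ e.base).right = e.base := DFunLike.congr_fun hright e.base
  have htgt : (Φ (e.base * b e.label)).left 1 =
      (Φ e.base).left 1 * Multiplicative.ofAdd (c e) := by
    simp [hΦ, hbase]
  exact sub_eq_iff_eq_add'.2 (congrArg Multiplicative.toAdd htgt)

theorem isTree_cayleyGraph (b : FreeGroupBasis S F) : (cayleyGraph b).IsTree where
  joined := joined_cayleyGraph (closure_range_basis b)
  separates_ends := separates_ends_of_coboundary_surjective (coboundary_cayleyGraph_surjective b)

end CayleyGraph

end OrientedGraph

/-! ### The rank bounds -/

section RankBounds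

variable {G : Type*} [Group G]

theorem zero_le_rank_sub_one {H : Subgroup G} [Group.FG H] (hH : H ≠ ⊥) :
    0 ≤ (Group.rank H : ℤ) - 1 := by
  have := (Subgroup.nontrivial_iff_ne_bot H).2 hH
  have := Group.rank_pos H
  lia

theorem rank_sub_one_le_sum (A : G → Subgroup G) [∀ g, Group.FG (A g)] {Y : Finset G}
    (hY : ∀ g ∈ Y, A g ≠ ⊥) {g : G} (hg : A g ≠ ⊥ → g ∈ Y) :
    (Group.rank (A g) : ℤ) - 1 ≤ ∑ y ∈ Y, ((Group.rank (A y) : ℤ) - 1) := by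
  have nonneg (y) (hy : y ∈ Y) := zero_le_rank_sub_one (hY y hy)
  by_cases h : A g = ⊥
  · have : Subsingleton (A g) := h ▸ inferInstance
    have rank_eq_zero : Group.rank (A g) = 0 := Group.rank_eq_zero _
    have := Finset.sum_nonneg nonneg
    lia
  · exact Finset.single_le_sum nonneg (hg h)

theorem mul_le_two_mul_mul_sub_min {a b : ℤ} (ha : 0 ≤ a) (hb : 0 ≤ b) :
    a * b ≤ 2 * a * b - min a b := by
  have min_le_mul : min a b ≤ a * b := by
    obtain rfl | ha := ha.eq_or_lt
    · simp [hb]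
    · exact (min_le_right a b).trans (le_mul_of_one_le_left hb ha)
  linarith

end RankBounds

theorem mainTheorem4_general {F : Type*} [Group F] [IsFreeGroup F] (H K : Subgroup F)
    [Group.FG ↥H] [Group.FG ↥K] (hH : H ≠ ⊥) (hK : K ≠ ⊥) :
    (∃ _ : Group.FG ↥(H ⊓ K),
      (Group.rank ↥(H ⊓ K) : ℤ) - 1 ≤
        ((Group.rank ↥H : ℤ) - 1) * ((Group.rank ↥K : ℤ) - 1)) ∧
    (∃ _ : ∀ g : F, Group.FG ↥(H ⊓ MulAut.conj g • K),
      ∀ X : Set F, Set.InjOn (DoubleCoset.mk H K) X →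
        ∃ hY : {g ∈ X | H ⊓ MulAut.conj g • K ≠ ⊥}.Finite,
          ∑ g ∈ hY.toFinset, ((Group.rank ↥(H ⊓ MulAut.conj g • K) : ℤ) - 1) ≤
            ((Group.rank ↥H : ℤ) - 1) * ((Group.rank ↥K : ℤ) - 1)) := by
  let b := IsFreeGroup.basis F
  let _ : LinearOrder (IsFreeGroup.Generators F) := IsWellOrder.linearOrder WellOrderingRel
  obtain ⟨_, _⟩ := exists_linearOrder_mulLeftStrictMono b
  obtain ⟨hfg, hsum⟩ := (OrientedGraph.isTree_cayleyGraph b).hanna_neumann H K hH hK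
  refine ⟨?_, hfg, hsum⟩
  obtain ⟨hY, hle⟩ := hsum {1} (injOn_singleton _ 1)
  have one_mem (h : H ⊓ MulAut.conj 1 • K ≠ ⊥) : 1 ∈ hY.toFinset :=
    hY.mem_toFinset.2 ⟨rfl, h⟩
  have inf_conj_one : H ⊓ MulAut.conj (1 : F) • K = H ⊓ K := by rw [map_one, one_smul]
  have hfg_inf : Group.FG ↥(H ⊓ K) := inf_conj_one ▸ hfg 1
  refine ⟨hfg_inf, ?_⟩
  rw [← Subgroup.rank_congr inf_conj_one]
  exact (rank_sub_one_le_sum (fun g => H ⊓ MulAut.conj g • K)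
    (fun g hg => (hY.mem_toFinset.1 hg).2) one_mem).trans hle

theorem mainTheorem4 {F : Type*} [Group F] [IsFreeGroup F] (H K : Subgroup F)
    [Group.FG ↥H] [Group.FG ↥K] (hH : H ≠ ⊥) (hK : K ≠ ⊥) :
    (∃ _ : Group.FG ↥(H ⊓ K),
      (Group.rank ↥(H ⊓ K) : ℤ) - 1 ≤
        2 * ((Group.rank ↥H : ℤ) - 1) * ((Group.rank ↥K : ℤ) - 1)
          - min ((Group.rank ↥H : ℤ) - 1) ((Group.rank ↥K : ℤ) - 1)) ∧
    (∃ _ : ∀ g : F, Group.FG ↥(H ⊓ MulAut.conj g • K),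
      ∀ X : Set F, Set.BijOn (DoubleCoset.mk H K) X Set.univ →
        ∃ hY : {g ∈ X | H ⊓ MulAut.conj g • K ≠ ⊥}.Finite,
          ∑ g ∈ hY.toFinset, ((Group.rank ↥(H ⊓ MulAut.conj g • K) : ℤ) - 1) ≤
            2 * ((Group.rank ↥H : ℤ) - 1) * ((Group.rank ↥K : ℤ) - 1)
              - min ((Group.rank ↥H : ℤ) - 1) ((Group.rank ↥K : ℤ) - 1)) := by
  obtain ⟨⟨hfg, hrank⟩, hfg', hsum⟩ := mainTheorem4_general H K hH hK
  have bound := mul_le_two_mul_mul_sub_min (zero_le_rank_sub_one hH) (zero_le_rank_sub_one hK)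
  exact ⟨⟨hfg, hrank.trans bound⟩, hfg', fun X hX => (hsum X hX.injOn).imp fun _ h => h.trans bound⟩
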